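/- **Setting.** Let $n,r,m$ be nonnegative integers. Let $g:\mathbb R^n\to\mathbb R\cup\{+\infty\}$ and $h:\mathbb R^r\to\mathbb R\cup\{+\infty\}$ be proper, closed, convex, let $L\in\mathbb R^{r\times n}$, and let $f:\mathbb R^n\to\mathbb R$ be convex and continuously differentiable with, for some $\beta_f\in[0,\infty)$ and some symmetric positive definite $Q$, $$\|\nabla f(x)-\nabla f(y)\|_{Q^{-1}}\le\beta_f\|x-y\|_Q\qquad\forall x,y\in\mathbb R^n .$$ Here $\|v\|_P^2=\langle v,Pv\rangle$ for a symmetric positive definite matrix $P$. Assume that the primal problem $\min_x f(x)+g(x)+h(Lx)$ has a solution and that there is $x\in\operatorname{ri}\operatorname{dom}g$ with $Lx\in\operatorname{ri}\operatorname{dom}h$. The dual problem is $\min_u (g+f)^*(-L^\top u)+h^*(u)$, where ${}^*$ denotes the Fenchel conjugate. Let $\mathcal S$ be the set of primal-dual solutions, i.e. of pairs $z=(u,x)\in\mathbb R^{r}\times\mathbb R^n$ such that $u$ solves the dual and $x$ solves the primal problem. Let the stepsize matrices $\Sigma\in\mathbb R^{r\times r}$ and $\Gamma\in\mathbb R^{n\times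 n}$ be diagonal and positive definite with $$\Gamma^{-1}-\tfrac{\beta_f}{2}Q-L^\top\Sigma L\succ0 .$$ With $\operatorname{prox}_\varphi^V(x)=\operatorname{argmin}_w\{\varphi(w)+\tfrac12\|x-w\|_V^2\}$, define for $z=(u,x)$ $$\bar u=\operatorname{prox}_{h^*}^{\Sigma^{-1}}(u+\Sigma Lx),\quad \bar x=\operatorname{prox}_{g}^{\Gamma^{-1}}(x-\Gamma\nabla f(x)-\Gamma L^\top\bar u),\quad Tz=(\bar u+\Sigma L(\bar x-x),\,\bar x).$$ Put $$S=\begin{pmatrix}\Sigma^{-1}&0\\0&\Gamma^{-1}\end{pmatrix},\qquad \tilde P=\begin{pmatrix}\Sigma^{-1}&-\tfrac12L\\-\tfrac12L^\top&\Gamma^{-1}-\tfrac{\beta_f}{4}Q\end{pmatrix}.$$ Let $U_1,\dots,U_m\in\mathbb R^{(r+n)\times(r+n)}$ be diagonal matrices with diagonal entries in $\{0,1\}$ and $\sum_{i=1}^mU_i=I$. On a probability space, let $\epsilon^1,\epsilon^2,\dots$ be i.i.d. random vectors with values in $\{0,1\}^m$ such that $p_i=\mathbb P(\epsilon^1_i=1)>0$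 for $i=1,\dots,m$ (the components of one vector need not be independent). Put $\Pi=\sum_{i=1}^mp_iU_i$. Starting from a deterministic $z^0=(u^0,x^0)$, let $$z^{k+1}=z^k+\sum_{i=1}^m\epsilon^{k+1}_iU_i(Tz^k-z^k),\qquad k=0,1,2,\dots,$$ and let $\mathbb E_k$ be the conditional expectation given the $\sigma$-algebra generated by $\epsilon^1,\dots,\epsilon^k$. **Theorem.** For every $z^\star\in\mathcal S$ and every $k\ge0$, the random variable $\|z^{k+1}-z^\star\|_{\Pi^{-1}S}^2$ is integrable and, almost surely, $$\mathbb E_k\big[\|z^{k+1}-z^\star\|_{\Pi^{-1}S}^2\big]\le\|z^k-z^\star\|_{\Pi^{-1}S}^2-\|Tz^k-z^k\|_{2\tilde P-S}^2 .$$ Consequently, $(z^k)_{k\ge 0}$ converges almost surely to some $z^\star\in\mathcal S$, that is, to an $\mathcal S$-valued random variable. -/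

import Mathlib

open MeasureTheory ProbabilityTheory Filter Topology

noncomputable section

namespace TriPD

section Weighted

variable {ι κ : Type} [Fintype ι] [DecidableEq ι] [Fintype κ] [DecidableEq κ]

/-- The vector `A x` for a real matrix `A` and a Euclidean vector `x`. -/
def app (A : Matrix ι κ ℝ) (x : EuclideanSpace ℝ κ) : EuclideanSpace ℝ ι :=
  Matrix.toEuclideanLin A x

/-- The quadratic form `⟨x, P x⟩`, i.e. the squared norm `‖x‖_P ^ 2`. -/
def normSqW (P : Matrix ι ι ℝ) (x : EuclideanSpace ℝ ι) : ℝ :=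
  inner ℝ x (app P x)

/-- The norm `‖x‖_P = √⟨x, P x⟩` induced by a positive definite matrix `P`. -/
def normW (P : Matrix ι ι ℝ) (x : EuclideanSpace ℝ ι) : ℝ :=
  Real.sqrt (normSqW P x)

end Weighted

section ConvexAnalysis

variable {ι : Type} [Fintype ι] [DecidableEq ι]

/-- The effective domain of an extended-real-valued function. -/
def dom (φ : EuclideanSpace ℝ ι → EReal) : Set (EuclideanSpace ℝ ι) :=
  {x | φ x < ⊤}

/-- Proper, closed (lower semicontinuous), convex functions with values in `ℝ ∪ {+∞}`. -/
structure ProperClosedConvex (φ : EuclideanSpace ℝ ι → EReal) : Prop where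
  ne_bot : ∀ x, φ x ≠ ⊥
  dom_nonempty : (dom φ).Nonempty
  lsc : LowerSemicontinuous φ
  convex_epigraph : Convex ℝ {q : EuclideanSpace ℝ ι × ℝ | φ q.1 ≤ (q.2 : EReal)}

/-- The Fenchel conjugate `φ^*(v) = sup_x ⟨v, x⟩ - φ(x)`. -/
def conj (φ : EuclideanSpace ℝ ι → EReal) (v : EuclideanSpace ℝ ι) : EReal :=
  ⨆ x : EuclideanSpace ℝ ι, ((inner ℝ v x : ℝ) : EReal) - φ x

/-- The objective `w ↦ φ(w) + ½ ‖x - w‖_V ^ 2` that defines the proximal point of `x`. -/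
def proxObj (V : Matrix ι ι ℝ) (φ : EuclideanSpace ℝ ι → EReal) (x w : EuclideanSpace ℝ ι) :
    EReal :=
  φ w + ((1 / 2 * normSqW V (x - w) : ℝ) : EReal)

/-- The proximal mapping `prox_φ^V(x) = argmin_w { φ(w) + ½ ‖x - w‖_V ^ 2 }`. For `V` positive
definite and `φ` proper, closed and convex the minimizer exists and is unique. -/
def prox (V : Matrix ι ι ℝ) (φ : EuclideanSpace ℝ ι → EReal) (x : EuclideanSpace ℝ ι) :
    EuclideanSpace ℝ ι :=
  Classical.epsilon fun p => ∀ w, proxObj V φ x p ≤ proxObj V φ x w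

end ConvexAnalysis

section Problem

variable {n r : ℕ}

/-- The primal objective `f(x) + g(x) + h(L x)`. -/
def primalObj (f : EuclideanSpace ℝ (Fin n) → ℝ) (g : EuclideanSpace ℝ (Fin n) → EReal)
    (h : EuclideanSpace ℝ (Fin r) → EReal) (L : Matrix (Fin r) (Fin n) ℝ)
    (x : EuclideanSpace ℝ (Fin n)) : EReal :=
  (f x : EReal) + g x + h (app L x)

/-- The dual objective `(g + f)^*(-Lᵀ u) + h^*(u)`. -/
def dualObj (f : EuclideanSpace ℝ (Fin n) → ℝ) (g : EuclideanSpace ℝ (Fin n) → EReal)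
    (h : EuclideanSpace ℝ (Fin r) → EReal) (L : Matrix (Fin r) (Fin n) ℝ)
    (u : EuclideanSpace ℝ (Fin r)) : EReal :=
  conj (fun x => g x + (f x : EReal)) (-app L.transpose u) + conj h u

/-- `x` solves the primal problem. -/
def IsPrimalSolution (f : EuclideanSpace ℝ (Fin n) → ℝ) (g : EuclideanSpace ℝ (Fin n) → EReal)
    (h : EuclideanSpace ℝ (Fin r) → EReal) (L : Matrix (Fin r) (Fin n) ℝ)
    (x : EuclideanSpace ℝ (Fin n)) : Prop :=
  ∀ y, primalObj f g h L x ≤ primalObj f g h L y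

/-- `u` solves the dual problem. -/
def IsDualSolution (f : EuclideanSpace ℝ (Fin n) → ℝ) (g : EuclideanSpace ℝ (Fin n) → EReal)
    (h : EuclideanSpace ℝ (Fin r) → EReal) (L : Matrix (Fin r) (Fin n) ℝ)
    (u : EuclideanSpace ℝ (Fin r)) : Prop :=
  ∀ v, dualObj f g h L u ≤ dualObj f g h L v

/-- The space of primal-dual vectors `z = (u, x)`, with `u ∈ ℝ^r` first and `x ∈ ℝ^n` second. -/
abbrev PD (r n : ℕ) : Type := EuclideanSpace ℝ (Fin r ⊕ Fin n)

/-- The component `u` of `z = (u, x)`. -/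
def dualPart (z : PD r n) : EuclideanSpace ℝ (Fin r) := WithLp.toLp 2 fun i => z (Sum.inl i)

/-- The component `x` of `z = (u, x)`. -/
def primalPart (z : PD r n) : EuclideanSpace ℝ (Fin n) := WithLp.toLp 2 fun j => z (Sum.inr j)

/-- The vector `z = (u, x)`. -/
def pair (u : EuclideanSpace ℝ (Fin r)) (x : EuclideanSpace ℝ (Fin n)) : PD r n :=
  WithLp.toLp 2 (Sum.elim (fun i => u i) (fun j => x j))

/-- The set of primal-dual solutions. -/
def solutionSet (f : EuclideanSpace ℝ (Fin n) → ℝ) (g : EuclideanSpace ℝ (Fin n) → EReal)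
    (h : EuclideanSpace ℝ (Fin r) → EReal) (L : Matrix (Fin r) (Fin n) ℝ) : Set (PD r n) :=
  {z | IsDualSolution f g h L (dualPart z) ∧ IsPrimalSolution f g h L (primalPart z)}

/-- The operator `T` of the triangularly preconditioned primal-dual algorithm, with dual stepsize
matrix `Sg` and primal stepsize matrix `Gm`: for `z = (u, x)`,
`ū = prox_{h^*}^{Sg⁻¹}(u + Sg L x)`, `x̄ = prox_g^{Gm⁻¹}(x - Gm ∇f(x) - Gm Lᵀ ū)` and
`T z = (ū + Sg L (x̄ - x), x̄)`. -/
def opT (f : EuclideanSpace ℝ (Fin n) → ℝ) (g : EuclideanSpace ℝ (Fin n) → EReal)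
    (h : EuclideanSpace ℝ (Fin r) → EReal) (L : Matrix (Fin r) (Fin n) ℝ)
    (Sg : Matrix (Fin r) (Fin r) ℝ) (Gm : Matrix (Fin n) (Fin n) ℝ) (z : PD r n) : PD r n :=
  let u := dualPart z
  let x := primalPart z
  let ub := prox Sg⁻¹ (conj h) (u + app Sg (app L x))
  let xb := prox Gm⁻¹ g (x - app Gm (gradient f x) - app Gm (app L.transpose ub))
  pair (ub + app Sg (app L (xb - x))) xb

/-- `S = blkdiag(Sg⁻¹, Gm⁻¹)`. -/
def matS (Sg : Matrix (Fin r) (Fin r) ℝ) (Gm : Matrix (Fin n) (Fin n) ℝ) :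
    Matrix (Fin r ⊕ Fin n) (Fin r ⊕ Fin n) ℝ :=
  Matrix.fromBlocks Sg⁻¹ 0 0 Gm⁻¹

/-- The matrix `P̃` with blocks `Sg⁻¹`, `-½ L`, `-½ Lᵀ` and `Gm⁻¹ - (β / 4) Q`. -/
def matPtilde (L : Matrix (Fin r) (Fin n) ℝ) (Sg : Matrix (Fin r) (Fin r) ℝ)
    (Gm Q : Matrix (Fin n) (Fin n) ℝ) (β : ℝ) : Matrix (Fin r ⊕ Fin n) (Fin r ⊕ Fin n) ℝ :=
  Matrix.fromBlocks Sg⁻¹ (-(1 / 2 : ℝ) • L) (-(1 / 2 : ℝ) • L.transpose)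
    (Gm⁻¹ - (β / 4) • Q)

end Problem

section BlockCoordinate

variable {n r m : ℕ}

/-- The block-coordinate operator `T̂^{(e)} z = z + ∑ i, e_i U_i (T z - z)`; `e i = true` means
that block `i` is active (`e_i = 1`). -/
def opThat (T : PD r n → PD r n)
    (U : Fin m → Matrix (Fin r ⊕ Fin n) (Fin r ⊕ Fin n) ℝ) (e : Fin m → Bool) (z : PD r n) :
    PD r n :=
  z + ∑ i, (if e i then (1 : ℝ) else 0) • app (U i) (T z - z)

/-- The iterates `z^0 = z0`, `z^{k+1} = T̂^{(e k)} z^k`, where `e k` is the activation vector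
drawn in iteration `k`. -/
def iterates (T : PD r n → PD r n)
    (U : Fin m → Matrix (Fin r ⊕ Fin n) (Fin r ⊕ Fin n) ℝ) (z0 : PD r n)
    (e : ℕ → Fin m → Bool) : ℕ → PD r n
  | 0 => z0
  | k + 1 => opThat T U (e k) (iterates T U z0 e k)

/-- The `σ`-algebra generated by the activation vectors drawn in the first `k` iterations,
`ε 0, …, ε (k - 1)`. -/
abbrev history {Ω : Type*} (ε : ℕ → Ω → Fin m → Bool) (k : ℕ) : MeasurableSpace Ω :=
  ⨆ j : Fin k, MeasurableSpace.comap (ε j) inferInstance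

/-- The activation probability `p_i = ℙ(ε_i = 1)` of block `i` in the first iteration. -/
def actProb {Ω : Type*} [MeasurableSpace Ω] (μ : Measure Ω) (ε : ℕ → Ω → Fin m → Bool)
    (i : Fin m) : ℝ :=
  μ.real {ω | ε 0 ω i = true}

/-- The activation probability matrix `∑ i, p_i U_i`. -/
def probMat (p : Fin m → ℝ) (U : Fin m → Matrix (Fin r ⊕ Fin n) (Fin r ⊕ Fin n) ℝ) :
    Matrix (Fin r ⊕ Fin n) (Fin r ⊕ Fin n) ℝ :=
  ∑ i, p i • U i

end BlockCoordinate

end TriPD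

end

/-! Primal-dual solutions are exactly the KKT pairs: `u` is a subgradient of `h` at `L x`, and
`-∇f(x) - Lᵀ u` is a subgradient of `g` at `x` (`mem_solutionSet_iff`). The relative interior
condition yields a multiplier for every primal solution, by supporting the epigraph of the
perturbation function with a nonvertical hyperplane. Hence there is no duality gap, and the
Fenchel–Young inequalities are tight for any pair of optimal points.

The deterministic core is `two_inner_matS_add_le`, which says that `‖Tz - z*‖_S² ≤ ‖z - z*‖_S² - ‖Tz
- z‖²_{2P̃-S}`. It adds the monotonicity inequalities of the subdifferentials of `g` and `h` between
the step from `z` and the KKT point. The gradient term costs at most `(β/4)‖x̄ - x‖_Q²`, and the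
correction `Σ L (x̄ - x)` in `T` is what makes the bilinear coupling terms cancel. By a Schur
complement the stepsize condition makes `2P̃ - S` positive definite.

Randomization loses nothing (`condExp_normSqW_iterates`). All weights are diagonal and each
coordinate lies in exactly one block, so `‖z^{k+1} - z*‖²` in the norm of `Π⁻¹S` is affine in the
activation indicators. Their conditional means `p_i` cancel the weights `p_i⁻¹`, which leaves
precisely the deterministic quantity in the `S`-norm, whatever the dependence between blocks.

Convergence follows from Robbins–Siegmund: almost surely the distances to `z*` converge and `Tz^k -
z^k → 0`. The exceptional null set depends on `z*`, so a countable dense set of solutions is used.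
An Opial-type argument (`exists_tendsto_of_quasiFejer`) with continuity of `T` identifies the limit
as a fixed point, hence a solution. -/

noncomputable section

namespace TriPD

/-! ### Quadratic forms and norms weighted by positive definite matrices -/

set_option linter.unusedSectionVars false

section WeightedLemmas

variable {ι κ τ : Type} [Fintype ι] [DecidableEq ι] [Fintype κ] [DecidableEq κ]
  [Fintype τ] [DecidableEq τ]

theorem app_apply (A : Matrix ι κ ℝ) (x : EuclideanSpace ℝ κ) (i : ι) :
    app A x i = ∑ j, A i j * x j := by
  simp [app, Matrix.toLpLin_apply, Matrix.mulVec, dotProduct]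

theorem app_add (A : Matrix ι κ ℝ) (x y : EuclideanSpace ℝ κ) :
    app A (x + y) = app A x + app A y := map_add _ _ _

theorem app_sub (A : Matrix ι κ ℝ) (x y : EuclideanSpace ℝ κ) :
    app A (x - y) = app A x - app A y := map_sub _ _ _

theorem app_smul (A : Matrix ι κ ℝ) (c : ℝ) (x : EuclideanSpace ℝ κ) :
    app A (c • x) = c • app A x := map_smul _ _ _

theorem app_neg (A : Matrix ι κ ℝ) (x : EuclideanSpace ℝ κ) : app A (-x) = -app A x :=
  map_neg _ _

theorem app_zero (A : Matrix ι κ ℝ) : app A 0 = 0 := map_zero _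

theorem matrix_sub_app (A B : Matrix ι κ ℝ) (x : EuclideanSpace ℝ κ) :
    app (A - B) x = app A x - app B x := by
  simp [app]

theorem matrix_smul_app (c : ℝ) (A : Matrix ι κ ℝ) (x : EuclideanSpace ℝ κ) :
    app (c • A) x = c • app A x := by
  simp [app]

theorem app_app (A : Matrix ι κ ℝ) (B : Matrix κ τ ℝ) (x : EuclideanSpace ℝ τ) :
    app A (app B x) = app (A * B) x := by
  simp [app, Matrix.toLpLin_apply]

theorem one_app (x : EuclideanSpace ℝ ι) : app 1 x = x := by
  simp [app]

theorem inner_app_right (A : Matrix ι κ ℝ) (x : EuclideanSpace ℝ ι) (y : EuclideanSpace ℝ κ) :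
    inner ℝ x (app A y) = inner ℝ (app A.transpose x) y := by
  simp only [PiLp.inner_apply, app_apply, RCLike.inner_apply, conj_trivial, Matrix.transpose_apply,
    Finset.mul_sum, Finset.sum_mul]
  rw [Finset.sum_comm]
  exact Finset.sum_congr rfl fun _ _ => Finset.sum_congr rfl fun _ _ => by ring

theorem continuous_app (A : Matrix ι κ ℝ) : Continuous (app A) :=
  LinearMap.continuous_of_finiteDimensional (Matrix.toEuclideanLin A)

theorem continuous_normSqW (P : Matrix ι ι ℝ) : Continuous (normSqW P) :=
  continuous_id.inner (continuous_app P)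

theorem normSqW_smul (P : Matrix ι ι ℝ) (c : ℝ) (x : EuclideanSpace ℝ ι) :
    normSqW P (c • x) = c ^ 2 * normSqW P x := by
  simp only [normSqW, app_smul, inner_smul_left, inner_smul_right, conj_trivial]
  ring

theorem normSqW_neg (P : Matrix ι ι ℝ) (x : EuclideanSpace ℝ ι) :
    normSqW P (-x) = normSqW P x := by
  simp [normSqW, app_neg]

theorem normSqW_zero (P : Matrix ι ι ℝ) : normSqW P 0 = 0 := by
  simp [normSqW]

theorem _root_.Matrix.PosDef.transpose_eq {P : Matrix ι ι ℝ} (hP : P.PosDef) : P.transpose = P := by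
  rw [← Matrix.conjTranspose_eq_transpose_of_trivial]; exact hP.isHermitian

theorem _root_.Matrix.PosDef.app_inv_app {P : Matrix ι ι ℝ} (hP : P.PosDef)
    (x : EuclideanSpace ℝ ι) : app P⁻¹ (app P x) = x := by
  rw [app_app, Matrix.nonsing_inv_mul _ ((Matrix.isUnit_iff_isUnit_det _).1 hP.isUnit), one_app]

theorem _root_.Matrix.PosDef.app_app_inv {P : Matrix ι ι ℝ} (hP : P.PosDef)
    (x : EuclideanSpace ℝ ι) : app P (app P⁻¹ x) = x := by
  rw [app_app, Matrix.mul_nonsing_inv _ ((Matrix.isUnit_iff_isUnit_det _).1 hP.isUnit), one_app]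

theorem _root_.Matrix.PosDef.inner_app {P : Matrix ι ι ℝ} (hP : P.PosDef)
    (x y : EuclideanSpace ℝ ι) : inner ℝ (app P x) y = inner ℝ x (app P y) := by
  rw [inner_app_right, hP.transpose_eq]

theorem _root_.Matrix.PosDef.inner_app_comm {P : Matrix ι ι ℝ} (hP : P.PosDef)
    (x y : EuclideanSpace ℝ ι) : inner ℝ x (app P y) = inner ℝ y (app P x) := by
  rw [← hP.inner_app, real_inner_comm]

theorem normSqW_add {P : Matrix ι ι ℝ} (hP : P.PosDef) (x y : EuclideanSpace ℝ ι) :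
    normSqW P (x + y) = normSqW P x + 2 * inner ℝ (app P x) y + normSqW P y := by
  simp only [normSqW, app_add, inner_add_left, inner_add_right, hP.inner_app, hP.inner_app_comm y x]
  ring

theorem normSqW_pos {P : Matrix ι ι ℝ} (hP : P.PosDef) {x : EuclideanSpace ℝ ι} (hx : x ≠ 0) :
    0 < normSqW P x := by
  have := hP.dotProduct_mulVec_pos (x := x.ofLp) (by simpa using hx)
  simpa [normSqW, app, Matrix.toLpLin_apply, PiLp.inner_apply, dotProduct, mul_comm] using this

theorem normSqW_nonneg {P : Matrix ι ι ℝ} (hP : P.PosDef) (x : EuclideanSpace ℝ ι) :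
    0 ≤ normSqW P x := by
  by_cases hx : x = 0
  · simp [hx, normSqW_zero]
  · exact (normSqW_pos hP hx).le

/-- A positive definite quadratic form dominates a positive multiple of the Euclidean norm. -/
theorem exists_mul_sq_norm_le_normSqW {P : Matrix ι ι ℝ} (hP : P.PosDef) :
    ∃ c > 0, ∀ x, c * ‖x‖ ^ 2 ≤ normSqW P x := by
  rcases (Metric.sphere (0 : EuclideanSpace ℝ ι) 1).eq_empty_or_nonempty with he | hne
  -- The unit sphere is empty only in dimension zero, where any constant serves.
  · refine ⟨1, one_pos, fun x => ?_⟩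
    by_cases hx : x = 0
    · simp [hx, normSqW_zero]
    · exfalso
      have : ‖x‖⁻¹ • x ∈ Metric.sphere (0 : EuclideanSpace ℝ ι) 1 := by
        simp [norm_smul, hx]
      simp [he] at this
  · obtain ⟨q, hq, hmin⟩ := (isCompact_sphere (0 : EuclideanSpace ℝ ι) 1).exists_isMinOn hne
      (continuous_normSqW P).continuousOn
    have hq0 : q ≠ 0 := by rintro rfl; simp at hq
    refine ⟨normSqW P q, normSqW_pos hP hq0, fun x => ?_⟩
    by_cases hx : x = 0
    · simp [hx, normSqW_zero]
    · have hn : ‖x‖ ≠ 0 := norm_ne_zero_iff.2 hx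
      have hm : ‖x‖⁻¹ • x ∈ Metric.sphere (0 : EuclideanSpace ℝ ι) 1 := by
        simp [norm_smul, hx]
      have := hmin hm
      simp only [Set.mem_ofPred_eq, normSqW_smul] at this
      calc normSqW P q * ‖x‖ ^ 2 ≤ (‖x‖⁻¹ ^ 2 * normSqW P x) * ‖x‖ ^ 2 := by gcongr
        _ = normSqW P x := by field_simp

theorem normW_smul (P : Matrix ι ι ℝ) {c : ℝ} (hc : 0 ≤ c) (x : EuclideanSpace ℝ ι) :
    normW P (c • x) = c * normW P x := by
  rw [normW, normSqW_smul, Real.sqrt_mul (sq_nonneg _), Real.sqrt_sq hc, normW]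

theorem sq_normW {P : Matrix ι ι ℝ} (hP : P.PosDef) (x : EuclideanSpace ℝ ι) :
    normW P x ^ 2 = normSqW P x := Real.sq_sqrt (normSqW_nonneg hP x)

/-- The Cauchy–Schwarz inequality for the dual pair of norms `‖·‖_{P⁻¹}` and `‖·‖_P`. -/
theorem inner_le_normW_inv_mul_normW {P : Matrix ι ι ℝ} (hP : P.PosDef)
    (a e : EuclideanSpace ℝ ι) : inner ℝ a e ≤ normW P⁻¹ a * normW P e := by
  -- This quadratic in `s` is `‖P⁻¹a - s e‖_P²`, so its discriminant is nonpositive.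
  have key : ∀ s : ℝ, 0 ≤ normSqW P e * (s * s) + (-2 * inner ℝ a e) * s + normSqW P⁻¹ a := by
    intro s
    have h := normSqW_nonneg hP (app P⁻¹ a + (-s) • e)
    rw [normSqW_add hP, normSqW_smul, hP.app_app_inv, inner_smul_right] at h
    have h2 : normSqW P (app P⁻¹ a) = normSqW P⁻¹ a := by
      rw [normSqW, hP.app_app_inv, normSqW, real_inner_comm]
    rw [h2] at h
    linarith
  have hd := discrim_le_zero key
  rw [discrim] at hd
  have h2 : (inner ℝ a e) ^ 2 ≤ (normW P⁻¹ a * normW P e) ^ 2 := by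
    rw [mul_pow, sq_normW hP, sq_normW hP.inv]
    linarith
  exact (le_abs_self _).trans (abs_le_of_sq_le_sq h2
    (mul_nonneg (Real.sqrt_nonneg _) (Real.sqrt_nonneg _)))

end WeightedLemmas

/-! ### Subgradients and Fenchel conjugates of extended-real-valued functions -/

section Subgradients

variable {ι : Type} [Fintype ι] [DecidableEq ι]

/-- `v` is a subgradient of `φ` at `p`, a point where `φ` is finite. -/
def HasSubgradient (φ : EuclideanSpace ℝ ι → EReal) (v p : EuclideanSpace ℝ ι) : Prop :=
  ∃ a : ℝ, φ p = a ∧ ∀ w, ((a + inner ℝ v (w - p) : ℝ) : EReal) ≤ φ w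

variable {φ : EuclideanSpace ℝ ι → EReal}

theorem HasSubgradient.inner_nonneg {v v' p p' : EuclideanSpace ℝ ι}
    (h : HasSubgradient φ v p) (h' : HasSubgradient φ v' p') :
    0 ≤ inner ℝ (v - v') (p - p') := by
  obtain ⟨a, ha, h⟩ := h
  obtain ⟨b, hb, h'⟩ := h'
  have h1 := h p'
  have h2 := h' p
  rw [hb, EReal.coe_le_coe_iff] at h1
  rw [ha, EReal.coe_le_coe_iff] at h2
  rw [← neg_sub p p', inner_neg_right] at h1
  rw [inner_sub_left]
  linarith

theorem le_conj (φ : EuclideanSpace ℝ ι → EReal) {p : EuclideanSpace ℝ ι} {a : ℝ} (ha : φ p = a)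
    (v : EuclideanSpace ℝ ι) : ((inner ℝ v p - a : ℝ) : EReal) ≤ conj φ v := by
  refine le_trans (le_of_eq ?_) (le_iSup _ p)
  rw [ha, EReal.coe_sub]

/-- Together with `HasSubgradient.of_conj_le` this is the equality case of Fenchel–Young; no
convexity is involved. -/
theorem HasSubgradient.conj_eq {v p : EuclideanSpace ℝ ι} {a : ℝ} (ha : φ p = a)
    (h : HasSubgradient φ v p) : conj φ v = ((inner ℝ v p - a : ℝ) : EReal) := by
  refine le_antisymm (iSup_le fun x => ?_) (le_conj φ ha v)
  obtain ⟨b, hb, h⟩ := h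
  obtain rfl : a = b := by rw [ha] at hb; exact_mod_cast hb
  have hx := h x
  induction hφ : φ x using EReal.rec with
  | bot => rw [hφ] at hx; exact absurd hx (by simp)
  | top => simp
  | coe s =>
    rw [hφ, EReal.coe_le_coe_iff, inner_sub_right] at hx
    rw [← EReal.coe_sub, EReal.coe_le_coe_iff]
    linarith

theorem HasSubgradient.of_conj_le {v p : EuclideanSpace ℝ ι} {a : ℝ} (ha : φ p = a)
    (h : conj φ v ≤ ((inner ℝ v p - a : ℝ) : EReal)) : HasSubgradient φ v p := by
  refine ⟨a, ha, fun w => ?_⟩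
  have hw := (le_iSup (fun x => ((inner ℝ v x : ℝ) : EReal) - φ x) w).trans h
  induction hφ : φ w using EReal.rec with
  | bot =>
    simp only [hφ, EReal.coe_sub_bot, top_le_iff] at hw
    exact absurd hw (EReal.coe_ne_top _)
  | top => simp
  | coe s =>
    simp only [hφ] at hw
    rw [← EReal.coe_sub, EReal.coe_le_coe_iff] at hw
    rw [EReal.coe_le_coe_iff, inner_sub_right]
    linarith

/-- A subgradient `v` of `φ` at `p` has `p` as a subgradient of the conjugate at `v`. -/
theorem HasSubgradient.hasSubgradient_conj {v p : EuclideanSpace ℝ ι} (h : HasSubgradient φ v p) :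
    HasSubgradient (conj φ) p v := by
  obtain ⟨a, ha, -⟩ := id h
  refine ⟨_, h.conj_eq ha, fun w => ?_⟩
  refine le_trans (le_of_eq ?_) (le_conj φ ha w)
  rw [EReal.coe_eq_coe_iff, inner_sub_right, real_inner_comm v p, real_inner_comm w p]
  ring

theorem ProperClosedConvex.exists_eq_coe (hφ : ProperClosedConvex φ) {x : EuclideanSpace ℝ ι}
    (hx : x ∈ dom φ) : ∃ a : ℝ, φ x = a :=
  ⟨(φ x).toReal, (EReal.coe_toReal (ne_of_lt hx) (hφ.ne_bot x)).symm⟩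

theorem ProperClosedConvex.add_smul_sub_le (hφ : ProperClosedConvex φ)
    {p w : EuclideanSpace ℝ ι} {a s t : ℝ} (ha : φ p = a) (hs : φ w = s) (h0 : 0 ≤ t)
    (h1 : t ≤ 1) : φ (p + t • (w - p)) ≤ (((1 - t) * a + t * s : ℝ) : EReal) := by
  have h := hφ.convex_epigraph (x := (p, a)) (y := (w, s)) (by simp [ha]) (by simp [hs])
    (a := 1 - t) (b := t) (by linarith) h0 (by ring)
  have e : p + t • (w - p) = (1 - t) • p + t • w := by module
  rw [e]
  simpa using h

/-- The first order optimality condition for the sum of a convex function and a function with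
directional derivatives at the minimizer. -/
theorem ProperClosedConvex.hasSubgradient_of_isMin (hφ : ProperClosedConvex φ)
    {q : EuclideanSpace ℝ ι → ℝ} {p v : EuclideanSpace ℝ ι}
    (hq : ∀ e, HasDerivAt (fun t : ℝ => q (p + t • e)) (inner ℝ v e) 0)
    (hmin : ∀ w, φ p + (q p : EReal) ≤ φ w + (q w : EReal)) : HasSubgradient φ (-v) p := by
  have hp : p ∈ dom φ := by
    obtain ⟨x, hx⟩ := hφ.dom_nonempty
    obtain ⟨b, hb⟩ := hφ.exists_eq_coe hx
    have h := hmin x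
    rw [hb, ← EReal.coe_add] at h
    by_contra hp
    have : φ p = ⊤ := not_lt_top_iff.1 hp
    simp only [this, EReal.top_add_coe, top_le_iff] at h
    exact EReal.coe_ne_top _ h
  obtain ⟨a, ha⟩ := hφ.exists_eq_coe hp
  refine ⟨a, ha, fun w => ?_⟩
  induction hw : φ w using EReal.rec with
  | bot => exact absurd hw (hφ.ne_bot w)
  | top => simp
  | coe s =>
    rw [EReal.coe_le_coe_iff]
    have hlim := (hq (w - p)).tendsto_slope_zero_right
    -- Minimality at `p + t(w - p)` and convexity of `φ` bound the difference quotients of `q` below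
    -- by `φ(p) - φ(w)`; their limit is `⟨v, w - p⟩`.
    have hle : ∀ᶠ t : ℝ in 𝓝[>] 0,
        a - s ≤ t⁻¹ • (q (p + (0 + t) • (w - p)) - q (p + (0 : ℝ) • (w - p))) := by
      filter_upwards [Ioo_mem_nhdsGT (show (0 : ℝ) < 1 from one_pos)] with t ht
      have h1 := hmin (p + t • (w - p))
      have h2 := hφ.add_smul_sub_le ha hw ht.1.le ht.2.le
      have h3 := h1.trans (add_le_add_left h2 _)
      rw [ha, ← EReal.coe_add, ← EReal.coe_add, EReal.coe_le_coe_iff] at h3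
      rw [zero_add, zero_smul, add_zero, smul_eq_mul, ← div_eq_inv_mul, le_div_iff₀ ht.1]
      linarith
    have := ge_of_tendsto hlim hle
    rw [inner_neg_left]
    linarith

end Subgradients

/-! ### Proximal mappings and Moreau's decomposition -/

section ProximalPoints

variable {ι : Type} [Fintype ι] [DecidableEq ι] {φ : EuclideanSpace ℝ ι → EReal}
  {V : Matrix ι ι ℝ}

/-- A proper closed convex function decreases at most linearly. -/
theorem ProperClosedConvex.exists_linear_growth (hφ : ProperClosedConvex φ)
    {x : EuclideanSpace ℝ ι} {a : ℝ} (ha : φ x = a) :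
    ∃ A : ℝ, 0 ≤ A ∧ ∀ w, 1 ≤ ‖w - x‖ → ((a - ‖w - x‖ * A : ℝ) : EReal) ≤ φ w := by
  obtain ⟨q, hq, hmin⟩ := hφ.lsc.lowerSemicontinuousOn (Metric.closedBall x 1)
    |>.exists_isMinOn ⟨x, by simp⟩ (isCompact_closedBall x 1)
  have hqx : φ q ≤ φ x := hmin (by simp)
  have hqd : q ∈ dom φ := by
    rw [dom, Set.mem_ofPred_eq]; exact hqx.trans_lt (by rw [ha]; exact EReal.coe_lt_top a)
  obtain ⟨m, hm⟩ := hφ.exists_eq_coe hqd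
  rw [hm, ha, EReal.coe_le_coe_iff] at hqx
  -- With `m` the minimum over the closed unit ball about `x`, convexity on the segment from `x` to
  -- `w`, evaluated at distance one, carries the bound `m` outwards linearly.
  refine ⟨a - m, by linarith, fun w hw => ?_⟩
  have hpos : 0 < ‖w - x‖ := by linarith
  induction hs : φ w using EReal.rec with
  | bot => exact absurd hs (hφ.ne_bot w)
  | top => simp
  | coe s =>
    have h1 := hφ.add_smul_sub_le ha hs (t := ‖w - x‖⁻¹) (by positivity) (inv_le_one_of_one_le₀ hw)
    have h2 : φ q ≤ φ (x + ‖w - x‖⁻¹ • (w - x)) := hmin (by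
      simp [norm_smul, inv_mul_cancel₀ hpos.ne'])
    have h3 := h2.trans h1
    rw [hm, EReal.coe_le_coe_iff] at h3
    rw [EReal.coe_le_coe_iff]
    have h4 := mul_le_mul_of_nonneg_left h3 hpos.le
    have h5 : ‖w - x‖ * ((1 - ‖w - x‖⁻¹) * a + ‖w - x‖⁻¹ * s) = ‖w - x‖ * a - a + s := by
      field_simp
    rw [h5] at h4
    linarith

theorem lowerSemicontinuous_proxObj (hφ : ProperClosedConvex φ) (x : EuclideanSpace ℝ ι) :
    LowerSemicontinuous (proxObj V φ x) := by
  refine hφ.lsc.add' (Continuous.lowerSemicontinuous ?_) fun w =>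
    EReal.continuousAt_add (Or.inr (EReal.coe_ne_bot _)) (Or.inl (hφ.ne_bot w))
  exact continuous_coe_real_ereal.comp
    (continuous_const.mul ((continuous_normSqW V).comp (continuous_const.sub continuous_id)))

/-- The quadratic term outgrows the at most linear decrease of `φ`, so a minimizer over a large ball
is global; on the ball, compactness and lower semicontinuity suffice. -/
theorem exists_isMin_proxObj (hφ : ProperClosedConvex φ) (hV : V.PosDef)
    (x : EuclideanSpace ℝ ι) : ∃ p, ∀ w, proxObj V φ x p ≤ proxObj V φ x w := by
  obtain ⟨x₀, hx₀⟩ := hφ.dom_nonempty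
  obtain ⟨a, ha⟩ := hφ.exists_eq_coe hx₀
  obtain ⟨A, hA, hgrow⟩ := hφ.exists_linear_growth ha
  obtain ⟨c, hc, hVc⟩ := exists_mul_sq_norm_le_normSqW hV
  set b := ‖x - x₀‖ with hb
  set N := 1 / 2 * normSqW V (x - x₀) with hN
  have hN0 : 0 ≤ N := mul_nonneg (by norm_num) (normSqW_nonneg hV _)
  have hb0 : 0 ≤ b := norm_nonneg _
  set K := A + b * A + N with hK
  have hK0 : 0 ≤ K := by positivity
  -- At distance `t > R` from `x₀` one has `(c/2)(t - b)² ≥ K(t - b) ≥ tA + N`; the last step uses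
  -- `t - b ≥ 1`. So the objective there is at least its value at `x₀`.
  set R := b + 1 + 2 * K / c with hR
  have hR1 : 0 ≤ 2 * K / c := by positivity
  obtain ⟨p, hp, hmin⟩ := (lowerSemicontinuous_proxObj (V := V) hφ x).lowerSemicontinuousOn
    (Metric.closedBall x₀ R) |>.exists_isMinOn ⟨x₀, by simp; positivity⟩ (isCompact_closedBall x₀ R)
  refine ⟨p, fun w => ?_⟩
  by_cases hw : w ∈ Metric.closedBall x₀ R
  · exact hmin hw
  · have hpx : proxObj V φ x p ≤ proxObj V φ x x₀ := hmin (by simp; positivity)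
    refine hpx.trans ?_
    rw [Metric.mem_closedBall, dist_eq_norm, not_le] at hw
    have hg := hgrow w (by linarith)
    set t := ‖w - x₀‖ with ht
    have htri : t - b ≤ ‖x - w‖ := by
      have := norm_sub_norm_le (w - x₀) (x - x₀)
      rwa [sub_sub_sub_cancel_right, norm_sub_rev w x] at this
    have hq : c * (t - b) ^ 2 ≤ normSqW V (x - w) := by
      refine le_trans ?_ (hVc (x - w))
      have : (t - b) ^ 2 ≤ ‖x - w‖ ^ 2 := pow_le_pow_left₀ (by linarith) htri 2
      gcongr
    have hKt : 2 * K ≤ c * (t - b) := by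
      have : 2 * K / c ≤ t - b := by linarith
      rw [div_le_iff₀ hc] at this
      linarith
    have h1 : 2 * K * (t - b) ≤ c * (t - b) ^ 2 := by
      have := mul_le_mul_of_nonneg_right hKt (show 0 ≤ t - b by linarith)
      linarith [this, sq (t - b)]
    have h2 : t * A + N ≤ K * (t - b) := by
      have : 0 ≤ (b * A + N) * (t - b - 1) := mul_nonneg (by positivity) (by linarith)
      rw [hK]
      nlinarith
    rw [proxObj, ha, ← EReal.coe_add]
    refine le_trans ?_ (add_le_add_left hg _)
    rw [← EReal.coe_add, EReal.coe_le_coe_iff]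
    linarith

theorem normSqW_sub_eq (hV : V.PosDef) (x p w : EuclideanSpace ℝ ι) :
    normSqW V (x - w)
      = normSqW V (x - p) - 2 * inner ℝ (app V (x - p)) (w - p) + normSqW V (w - p) := by
  have : x - w = (x - p) + -(w - p) := by abel
  rw [this, normSqW_add hV, normSqW_neg, inner_neg_right]
  ring

/-- A point that satisfies the optimality condition of the proximal problem is the proximal
point. -/
theorem prox_eq_of_hasSubgradient (hV : V.PosDef) {x p : EuclideanSpace ℝ ι}
    (h : HasSubgradient φ (app V (x - p)) p) : prox V φ x = p := by
  obtain ⟨a, ha, h⟩ := h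
  -- Strong convexity: the excess `½‖w - p‖_V²` forces uniqueness, so the point chosen by
  -- `Classical.epsilon` is `p`.
  have key : ∀ w, ((a + 1 / 2 * normSqW V (x - p) + 1 / 2 * normSqW V (w - p) : ℝ) : EReal)
      ≤ proxObj V φ x w := by
    intro w
    refine le_trans ?_ (add_le_add_left (h w) _)
    rw [← EReal.coe_add, EReal.coe_le_coe_iff, normSqW_sub_eq hV x p w]
    linarith
  have hp : proxObj V φ x p = ((a + 1 / 2 * normSqW V (x - p) : ℝ) : EReal) := by
    rw [proxObj, ha, EReal.coe_add]
  have hmin : ∀ w, proxObj V φ x p ≤ proxObj V φ x w := by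
    intro w
    refine le_trans ?_ (key w)
    rw [hp, EReal.coe_le_coe_iff]
    linarith [normSqW_nonneg hV (w - p)]
  have hspec : ∀ w, proxObj V φ x (prox V φ x) ≤ proxObj V φ x w :=
    Classical.epsilon_spec (p := fun p => ∀ w, proxObj V φ x p ≤ proxObj V φ x w) ⟨p, hmin⟩
  have h1 := (key (prox V φ x)).trans (hspec p)
  rw [hp, EReal.coe_le_coe_iff] at h1
  by_contra hne
  have := normSqW_pos hV (sub_ne_zero.2 hne)
  linarith

theorem hasSubgradient_prox (hφ : ProperClosedConvex φ) (hV : V.PosDef)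
    (x : EuclideanSpace ℝ ι) : HasSubgradient φ (app V (x - prox V φ x)) (prox V φ x) := by
  have hspec : ∀ w, proxObj V φ x (prox V φ x) ≤ proxObj V φ x w :=
    Classical.epsilon_spec (p := fun p => ∀ w, proxObj V φ x p ≤ proxObj V φ x w)
      (exists_isMin_proxObj hφ hV x)
  generalize prox V φ x = p at hspec
  rw [← neg_neg (app V (x - p))]
  refine hφ.hasSubgradient_of_isMin (q := fun w => 1 / 2 * normSqW V (x - w)) (fun e => ?_) hspec
  have he : (fun t : ℝ => 1 / 2 * normSqW V (x - (p + t • e))) = fun t : ℝ =>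
      1 / 2 * normSqW V (x - p) - t * inner ℝ (app V (x - p)) e + t ^ 2 * (1 / 2 * normSqW V e) := by
    funext t
    rw [normSqW_sub_eq hV x p, add_sub_cancel_left, inner_smul_right, normSqW_smul]
    ring
  rw [he, inner_neg_left]
  have h1 := ((hasDerivAt_id (0 : ℝ)).mul_const (inner ℝ (app V (x - p)) e)).const_sub
    (1 / 2 * normSqW V (x - p))
  have h2 := h1.add ((hasDerivAt_pow 2 (0 : ℝ)).mul_const (1 / 2 * normSqW V e))
  exact h2.congr_deriv (by simp)

/-- Monotonicity of the subdifferential makes the proximal mapping Lipschitz. -/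
theorem continuous_prox (hφ : ProperClosedConvex φ) (hV : V.PosDef) : Continuous (prox V φ) := by
  obtain ⟨c, hc, hVc⟩ := exists_mul_sq_norm_le_normSqW hV
  have key : ∀ x y, ‖prox V φ x - prox V φ y‖ ≤ c⁻¹ * ‖app V (x - y)‖ := by
    intro x y
    have h := (hasSubgradient_prox hφ hV x).inner_nonneg (hasSubgradient_prox hφ hV y)
    set d := prox V φ x - prox V φ y with hd
    have e : app V (x - prox V φ x) - app V (y - prox V φ y) = app V (x - y) - app V d := by
      rw [hd]; simp only [app_sub]; abel
    rw [e, inner_sub_left, hV.inner_app d d] at h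
    have h1 := hVc d
    have h2 := real_inner_le_norm (app V (x - y)) d
    rw [normSqW] at h1
    rw [← div_eq_inv_mul, le_div_iff₀ hc]
    by_cases hd0 : ‖d‖ = 0
    · rw [hd0]; simp
    · have hpos : 0 < ‖d‖ := lt_of_le_of_ne (norm_nonneg _) (Ne.symm hd0)
      refine le_of_mul_le_mul_right ?_ hpos
      linarith [sq ‖d‖]
  refine continuous_iff_continuousAt.2 fun y => ?_
  rw [ContinuousAt, tendsto_iff_norm_sub_tendsto_zero]
  refine squeeze_zero (fun _ => norm_nonneg _) (fun x => key x y) ?_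
  have : Continuous fun x => c⁻¹ * ‖app V (x - y)‖ :=
    continuous_const.mul ((continuous_app V).comp (continuous_id.sub continuous_const)).norm
  have h := this.tendsto y
  simpa [app_zero] using h

/-- Moreau's decomposition: the proximal mapping of the conjugate. -/
theorem prox_conj_eq (hφ : ProperClosedConvex φ) (hV : V.PosDef) (a : EuclideanSpace ℝ ι) :
    prox V⁻¹ (conj φ) a = a - app V (prox V φ (app V⁻¹ a)) := by
  -- With `p = prox V φ (V⁻¹a)`, the vector `w = a - Vp` is a subgradient of `φ` at `p`. Hence `p =
  -- V⁻¹(a - w)` is a subgradient of the conjugate at `w`, which is its proximal optimality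
  -- condition. Properness, closedness and convexity of the conjugate are never needed.
  refine prox_eq_of_hasSubgradient hV.inv ?_
  have h := (hasSubgradient_prox hφ hV (app V⁻¹ a)).hasSubgradient_conj
  rw [app_sub, hV.app_app_inv] at h
  rwa [sub_sub_cancel, hV.app_inv_app]

/-- The proximal point of the conjugate is a subgradient of the original function. -/
theorem hasSubgradient_prox_conj (hφ : ProperClosedConvex φ) (hV : V.PosDef)
    (a : EuclideanSpace ℝ ι) :
    HasSubgradient φ (prox V⁻¹ (conj φ) a) (app V⁻¹ (a - prox V⁻¹ (conj φ) a)) := by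
  have h := hasSubgradient_prox hφ hV (app V⁻¹ a)
  rw [app_sub, hV.app_app_inv] at h
  rwa [prox_conj_eq hφ hV, sub_sub_cancel, hV.app_inv_app]

theorem continuous_prox_conj (hφ : ProperClosedConvex φ) (hV : V.PosDef) :
    Continuous (prox V⁻¹ (conj φ)) := by
  rw [funext (prox_conj_eq hφ hV)]
  exact continuous_id.sub ((continuous_app V).comp ((continuous_prox hφ hV).comp
    (continuous_app V⁻¹)))

end ProximalPoints

/-! ### Nonvertical supporting hyperplanes and relative interiors -/

section Separation

variable {E : Type*} [AddCommGroup E] [Module ℝ E]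

/-- The linear span of a convex set that absorbs the negatives of its points. -/
def absorbedSubmodule (A : Set E) (hA : Convex ℝ A) (h0 : (0 : E) ∈ A)
    (hneg : ∀ a ∈ A, ∃ δ : ℝ, 0 < δ ∧ -(δ • a) ∈ A) : Submodule ℝ E where
  carrier := {y | ∃ c : ℝ, 0 < c ∧ c • y ∈ A}
  zero_mem' := ⟨1, one_pos, by simpa using h0⟩
  add_mem' := by
    rintro y y' ⟨c, hc, hy⟩ ⟨c', hc', hy'⟩
    -- The scaling for which `y + y'` becomes a convex combination of `c • y` and `c' • y'`.
    refine ⟨c * c' / (c + c'), by positivity, ?_⟩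
    have h := hA hy hy' (a := c' / (c + c')) (b := c / (c + c')) (by positivity) (by positivity)
      (by field_simp; ring)
    convert h using 1
    rw [smul_smul, smul_smul, smul_add]
    congr 2 <;> ring
  smul_mem' := by
    rintro r y ⟨c, hc, hy⟩
    rcases lt_trichotomy r 0 with hr | rfl | hr
    · obtain ⟨δ, hδ, h⟩ := hneg _ hy
      refine ⟨δ * c / -r, div_pos (by positivity) (by linarith), ?_⟩
      convert h using 1
      rw [smul_smul, smul_smul, ← neg_smul]
      congr 1
      have := hr.ne
      field_simp
    · exact ⟨1, one_pos, by simpa using h0⟩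
    · refine ⟨c / r, by positivity, ?_⟩
      rwa [smul_smul, div_mul_cancel₀ _ hr.ne']

/-- A convex set in `E × ℝ` has a nonvertical supporting hyperplane at a lowest point over a
relative algebraic interior point of its projection. -/
theorem exists_nonvertical_support {K : Set (E × ℝ)} (hK : Convex ℝ K) {m : ℝ}
    (hm : ((0 : E), m) ∈ K) (hmin : ∀ t, ((0 : E), t) ∈ K → m ≤ t)
    (hneg : ∀ a ∈ Prod.fst '' K, ∃ δ : ℝ, 0 < δ ∧ -(δ • a) ∈ Prod.fst '' K) :
    ∃ l : E →ₗ[ℝ] ℝ, ∀ q ∈ K, m + l q.1 ≤ q.2 := by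
  have hA : Convex ℝ (Prod.fst '' K) := hK.linear_image (LinearMap.fst ℝ E ℝ)
  let M := absorbedSubmodule (Prod.fst '' K) hA ⟨_, hm, rfl⟩ hneg
  have hMA : ∀ y ∈ Prod.fst '' K, y ∈ M := fun y hy => ⟨1, one_pos, by simpa using hy⟩
  -- The set is recentred so that its lowest point over `0` is the origin. The second coordinate, a
  -- functional on the vertical axis, is then nonnegative where that axis meets the cone over `K'`,
  -- and M. Riesz's extension theorem extends it positively to `M × ℝ`.
  let K' : Set (M × ℝ) := {q | ((q.1 : E), q.2 + m) ∈ K}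
  have hK' : Convex ℝ K' := by
    intro p hp q hq a b ha hb hab
    have h := hK hp hq ha hb hab
    have e : a • ((p.1 : E), p.2 + m) + b • ((q.1 : E), q.2 + m)
        = (((a • p + b • q).1 : E), (a • p + b • q).2 + m) := by
      ext
      · simp
      · simp only [Prod.smul_mk, Prod.mk_add_mk, smul_eq_mul, Prod.snd_add, Prod.smul_snd]
        linear_combination m * hab
    rw [e] at h
    exact h
  have h0 : (0 : M × ℝ) ∈ ConvexCone.hull ℝ K' :=
    (ConvexCone.mem_hull_of_convex hK').2 ⟨1, one_pos, 0, by simpa [K'] using hm, by simp⟩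
  let f : (M × ℝ) →ₗ.[ℝ] ℝ :=
    ⟨LinearMap.range (LinearMap.inr ℝ M ℝ),
      (LinearMap.snd ℝ M ℝ).domRestrict (LinearMap.range (LinearMap.inr ℝ M ℝ))⟩
  obtain ⟨G, hG, hpos⟩ := riesz_extension ((ConvexCone.hull ℝ K').toPointedCone h0) f (by
      rintro ⟨_, t, rfl⟩ hx
      obtain ⟨c, hc, ⟨y, s⟩, hy, he⟩ := (ConvexCone.mem_hull_of_convex hK').1 hx
      simp only [Prod.smul_mk, LinearMap.inr_apply, Prod.mk.injEq, smul_eq_mul] at he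
      obtain ⟨h1, h2⟩ := he
      have hy0 : y = 0 := (smul_eq_zero.1 h1).resolve_left hc.ne'
      subst hy0
      have : 0 ≤ s := by linarith [hmin _ hy]
      change 0 ≤ t
      rw [← h2]
      positivity) (by
      -- Any `(y, s)` enters the cone after a vertical shift: `c • y` lies below some point of `K`,
      -- and one rescales by `c⁻¹`.
      rintro ⟨⟨y, c, hc, ⟨⟨y', t⟩, hq, hy⟩⟩, s⟩
      refine ⟨⟨(0, (t - m) / c - s), ⟨_, rfl⟩⟩, (ConvexCone.mem_hull_of_convex hK').2
        ⟨c⁻¹, by positivity, (c • ⟨y, c, hc, ⟨⟨y', t⟩, hq, hy⟩⟩, t - m), ?_, ?_⟩⟩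
      · simp only at hy
        subst hy
        simpa [K'] using hq
      · simp only [Prod.smul_mk, Prod.mk_add_mk, zero_add, smul_eq_mul, Prod.mk.injEq]
        refine ⟨inv_smul_smul₀ hc.ne' _, ?_⟩
        rw [sub_add_cancel, div_eq_inv_mul])
  -- `G` is the identity on the vertical axis, so the hyperplane is a graph over `M` with slope
  -- `-G(·, 0)`.
  obtain ⟨l, hl⟩ := LinearMap.exists_extend (-(G ∘ₗ LinearMap.inl ℝ M ℝ))
  refine ⟨l, fun q hq => ?_⟩
  have hqM : q.1 ∈ M := hMA _ ⟨q, hq, rfl⟩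
  have h1 : 0 ≤ G (⟨q.1, hqM⟩, q.2 - m) := by
    refine hpos _ ((ConvexCone.mem_hull_of_convex hK').2 ⟨1, one_pos, _, ?_, one_smul _ _⟩)
    simpa [K'] using hq
  have h2 : G (0, q.2 - m) = q.2 - m := hG ⟨(0, q.2 - m), ⟨_, rfl⟩⟩
  have h3 : ((⟨q.1, hqM⟩, q.2 - m) : M × ℝ) = (⟨q.1, hqM⟩, 0) + (0, q.2 - m) := by simp
  rw [h3, map_add, h2] at h1
  have h4 : l q.1 = -G (⟨q.1, hqM⟩, 0) := LinearMap.congr_fun hl ⟨q.1, hqM⟩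
  linarith

end Separation

/-- From a relative interior point of a set one can move slightly away from any point of the set. -/
theorem exists_add_smul_sub_mem_of_mem_intrinsicInterior {E : Type*} [NormedAddCommGroup E]
    [NormedSpace ℝ E] {C : Set E} {x c : E} (hx : x ∈ intrinsicInterior ℝ C) (hc : c ∈ C) :
    ∃ δ₀ > 0, ∀ δ : ℝ, 0 ≤ δ → δ < δ₀ → x + δ • (x - c) ∈ C := by
  obtain ⟨y, hy, rfl⟩ := mem_intrinsicInterior.1 hx
  let γ : ℝ → affineSpan ℝ C := fun δ =>
    ⟨(y : E) + δ • ((y : E) - c), by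
      have := AffineMap.lineMap_mem (-δ) y.2 (subset_affineSpan ℝ C hc)
      convert this using 1
      rw [AffineMap.lineMap_apply, vsub_eq_sub, vadd_eq_add]
      module⟩
  have hγ : Continuous γ := by
    refine Continuous.subtype_mk ?_ _
    fun_prop
  have h0 : γ 0 = y := by ext; simp [γ]
  have hmem : γ ⁻¹' interior (Subtype.val ⁻¹' C) ∈ 𝓝 (0 : ℝ) :=
    hγ.continuousAt.preimage_mem_nhds (by rw [h0]; exact isOpen_interior.mem_nhds hy)
  obtain ⟨δ₀, hδ₀, hball⟩ := Metric.mem_nhds_iff.1 hmem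
  refine ⟨δ₀, hδ₀, fun δ h0 h1 => ?_⟩
  have : δ ∈ Metric.ball (0 : ℝ) δ₀ := by simpa [abs_of_nonneg h0] using h1
  exact interior_subset (s := Subtype.val ⁻¹' C) (hball this)

/-! ### The smooth term: gradient inequality, descent lemma, cocoercivity -/

section SmoothPart

variable {n : ℕ} {f : EuclideanSpace ℝ (Fin n) → ℝ}

theorem hasDerivAt_line (hf : ContDiff ℝ 1 f) (p e : EuclideanSpace ℝ (Fin n)) (t : ℝ) :
    HasDerivAt (fun t : ℝ => f (p + t • e)) (inner ℝ (gradient f (p + t • e)) e) t := by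
  have h1 : HasFDerivAt f _ (p + t • e) :=
    ((hf.differentiable one_ne_zero) (p + t • e)).hasGradientAt.hasFDerivAt
  have h2 : HasDerivAt (fun t : ℝ => p + t • e) e t := by
    simpa using ((hasDerivAt_id t).smul_const e).const_add p
  exact (h1.comp_hasDerivAt t h2).congr_deriv (by simp)

theorem continuous_gradient (hf : ContDiff ℝ 1 f) : Continuous (gradient f) :=
  (InnerProductSpace.toDual ℝ _).symm.continuous.comp (hf.continuous_fderiv one_ne_zero)

theorem add_inner_gradient_le (hf : ContDiff ℝ 1 f) (hc : ConvexOn ℝ Set.univ f)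
    (x w : EuclideanSpace ℝ (Fin n)) : f x + inner ℝ (gradient f x) (w - x) ≤ f w := by
  have h := hasDerivAt_line hf x (w - x) 0
  have hlim := h.tendsto_slope_zero_right
  have hle : ∀ᶠ t : ℝ in 𝓝[>] 0,
      t⁻¹ • (f (x + (0 + t) • (w - x)) - f (x + (0 : ℝ) • (w - x))) ≤ f w - f x := by
    filter_upwards [Ioo_mem_nhdsGT (show (0 : ℝ) < 1 from one_pos)] with t ht
    have h1 := hc.2 (Set.mem_univ x) (Set.mem_univ w) (show 0 ≤ 1 - t by linarith [ht.2])
      ht.1.le (by ring)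
    have e : (1 - t) • x + t • w = x + t • (w - x) := by module
    rw [e, smul_eq_mul, smul_eq_mul] at h1
    rw [zero_add, zero_smul, add_zero, smul_eq_mul, ← div_eq_inv_mul, div_le_iff₀ ht.1]
    linarith
  have := le_of_tendsto hlim hle
  rw [zero_smul, add_zero] at this
  linarith

variable {Q : Matrix (Fin n) (Fin n) ℝ} {β : ℝ}

/-- The descent lemma. -/
theorem le_add_inner_gradient_add (hf : ContDiff ℝ 1 f) (hQ : Q.PosDef)
    (hlip : ∀ x y, normW Q⁻¹ (gradient f x - gradient f y) ≤ β * normW Q (x - y))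
    (y e : EuclideanSpace ℝ (Fin n)) :
    f (y + e) ≤ f y + inner ℝ (gradient f y) e + β / 2 * normSqW Q e := by
  set ψ : ℝ → ℝ := fun t =>
    f (y + t • e) - t * inner ℝ (gradient f y) e - t ^ 2 * (β / 2 * normSqW Q e) with hψ
  have hd : ∀ t, HasDerivAt ψ (inner ℝ (gradient f (y + t • e)) e - inner ℝ (gradient f y) e
      - 2 * t * (β / 2 * normSqW Q e)) t := by
    intro t
    have h := ((hasDerivAt_line hf y e t).sub
      ((hasDerivAt_id t).mul_const (inner ℝ (gradient f y) e))).sub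
      ((hasDerivAt_pow 2 t).mul_const (β / 2 * normSqW Q e))
    exact h.congr_deriv (by simp)
  -- The derivative of `ψ` at `t > 0` is nonpositive by Cauchy–Schwarz and the Lipschitz bound; then
  -- `ψ 1 ≤ ψ 0` is the claim.
  have hanti : AntitoneOn ψ (Set.Ici 0) := by
    refine antitoneOn_of_deriv_nonpos (convex_Ici 0)
      (fun t _ => (hd t).continuousAt.continuousWithinAt)
      (fun t _ => (hd t).differentiableAt.differentiableWithinAt) fun t ht => ?_
    rw [interior_Ici, Set.mem_Ioi] at ht
    rw [(hd t).deriv, ← inner_sub_left]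
    have h1 := inner_le_normW_inv_mul_normW hQ (gradient f (y + t • e) - gradient f y) e
    have h2 := hlip (y + t • e) y
    rw [add_sub_cancel_left, normW_smul Q ht.le] at h2
    have h3 := mul_le_mul_of_nonneg_right h2 (show 0 ≤ normW Q e from Real.sqrt_nonneg _)
    rw [← sq_normW hQ]
    linarith [sq (normW Q e)]
  have h := hanti (Set.mem_Ici.2 le_rfl) (Set.mem_Ici.2 zero_le_one) zero_le_one
  simp only [hψ, one_smul, zero_smul, add_zero] at h
  linarith

/-- The three point consequence of the cocoercivity of the gradient. -/
theorem neg_quarter_le_inner_gradient_sub (hf : ContDiff ℝ 1 f) (hc : ConvexOn ℝ Set.univ f)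
    (hQ : Q.PosDef)
    (hlip : ∀ x y, normW Q⁻¹ (gradient f x - gradient f y) ≤ β * normW Q (x - y))
    (x y w : EuclideanSpace ℝ (Fin n)) :
    -(β / 4 * normSqW Q (w - x)) ≤ inner ℝ (gradient f x - gradient f y) (w - y) := by
  have key : ∀ x y e : EuclideanSpace ℝ (Fin n), f x + inner ℝ (gradient f x) (y + e - x)
      ≤ f y + inner ℝ (gradient f y) e + β / 2 * normSqW Q e := fun x y e =>
    (add_inner_gradient_le hf hc x (y + e)).trans (le_add_inner_gradient_add hf hQ hlip y e)
  -- Adding the two instances cancels the values of `f`. Displacements `-s(w - x)` and `(1 - s)(w -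
  -- x)` would cost `(β/2)(s² + (1 - s)²)`, which is least, namely `β/4`, at `s = 1/2`.
  have h1 := key x y (-(1 / 2 : ℝ) • (w - x))
  have h2 := key y x ((1 / 2 : ℝ) • (w - x))
  rw [normSqW_smul] at h1 h2
  have e1 : y + -(1 / 2 : ℝ) • (w - x) - x = -(w - y) + (1 / 2 : ℝ) • (w - x) := by module
  have e2 : x + (1 / 2 : ℝ) • (w - x) - y = (w - y) + -(1 / 2 : ℝ) • (w - x) := by module
  rw [e1, inner_add_right, inner_neg_right] at h1
  rw [e2, inner_add_right] at h2
  simp only [inner_smul_right] at h1 h2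
  rw [inner_sub_left]
  linarith

end SmoothPart

/-! ### Lagrange multipliers, strong duality and the KKT conditions -/

section Duality

variable {n r : ℕ} {f : EuclideanSpace ℝ (Fin n) → ℝ} {g : EuclideanSpace ℝ (Fin n) → EReal}
  {h : EuclideanSpace ℝ (Fin r) → EReal} {L : Matrix (Fin r) (Fin n) ℝ}

theorem dom_of_le_coe {ι : Type} {φ : EuclideanSpace ℝ ι → EReal} {x : EuclideanSpace ℝ ι} {a : ℝ}
    (hx : φ x ≤ a) : x ∈ dom φ :=
  hx.trans_lt (EReal.coe_lt_top a)

theorem IsPrimalSolution.exists_eq_coe (hg : ProperClosedConvex g) (hh : ProperClosedConvex h)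
    {x x₀ : EuclideanSpace ℝ (Fin n)} (hx : IsPrimalSolution f g h L x) (hx₀ : x₀ ∈ dom g)
    (hLx₀ : app L x₀ ∈ dom h) : ∃ a b : ℝ, g x = a ∧ h (app L x) = b := by
  obtain ⟨a₀, ha₀⟩ := hg.exists_eq_coe hx₀
  obtain ⟨b₀, hb₀⟩ := hh.exists_eq_coe hLx₀
  have hle := hx x₀
  simp only [primalObj, ha₀, hb₀, ← EReal.coe_add] at hle
  have hlt := lt_of_le_of_lt hle (EReal.coe_lt_top _)
  have h1 : x ∈ dom g := by
    by_contra hn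
    have ht : g x = ⊤ := not_lt_top_iff.1 hn
    rw [ht, EReal.coe_add_top, EReal.top_add_of_ne_bot (hh.ne_bot _)] at hlt
    exact lt_irrefl _ hlt
  obtain ⟨a, ha⟩ := hg.exists_eq_coe h1
  have h2 : app L x ∈ dom h := by
    by_contra hn
    have ht : h (app L x) = ⊤ := not_lt_top_iff.1 hn
    rw [ht, ha, ← EReal.coe_add, EReal.coe_add_top] at hlt
    exact lt_irrefl _ hlt
  obtain ⟨b, hb⟩ := hh.exists_eq_coe h2
  exact ⟨a, b, ha, hb⟩

/-- The epigraph of the value function `y ↦ inf_x f(x) + g(x) + h(L x + y)`. -/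
def perturbationEpigraph (f : EuclideanSpace ℝ (Fin n) → ℝ) (g : EuclideanSpace ℝ (Fin n) → EReal)
    (h : EuclideanSpace ℝ (Fin r) → EReal) (L : Matrix (Fin r) (Fin n) ℝ) :
    Set (EuclideanSpace ℝ (Fin r) × ℝ) :=
  {q | ∃ (x : EuclideanSpace ℝ (Fin n)) (a : ℝ) (w : EuclideanSpace ℝ (Fin r)) (b : ℝ),
    g x ≤ a ∧ h w ≤ b ∧ q.1 = w - app L x ∧ f x + a + b ≤ q.2}

theorem convex_perturbationEpigraph (hg : ProperClosedConvex g) (hh : ProperClosedConvex h)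
    (hc : ConvexOn ℝ Set.univ f) : Convex ℝ (perturbationEpigraph f g h L) := by
  rintro p ⟨x, a, w, b, ha, hb, hp, hle⟩ q ⟨x', a', w', b', ha', hb', hq, hle'⟩ s t hs ht hst
  have h1 := hg.convex_epigraph (x := (x, a)) ha (y := (x', a')) ha' hs ht hst
  have h2 := hh.convex_epigraph (x := (w, b)) hb (y := (w', b')) hb' hs ht hst
  have h3 := hc.2 (Set.mem_univ x) (Set.mem_univ x') hs ht hst
  refine ⟨_, _, _, _, h1, h2, ?_, ?_⟩
  · simp only [Prod.fst_add, Prod.smul_fst, hp, hq, app_add, app_smul]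
    module
  · simp only [Prod.fst_add, Prod.smul_fst, Prod.snd_add, Prod.smul_snd, smul_eq_mul] at h3 ⊢
    have h4 := mul_le_mul_of_nonneg_left hle hs
    have h5 := mul_le_mul_of_nonneg_left hle' ht
    linarith

/-- Existence of Lagrange multipliers under the relative interior qualification condition. -/
theorem IsPrimalSolution.exists_multiplier (hg : ProperClosedConvex g) (hh : ProperClosedConvex h)
    (hc : ConvexOn ℝ Set.univ f)
    (h_ri : ∃ x ∈ intrinsicInterior ℝ (dom g), app L x ∈ intrinsicInterior ℝ (dom h))
    {x : EuclideanSpace ℝ (Fin n)} (hx : IsPrimalSolution f g h L x) :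
    ∃ u, HasSubgradient h u (app L x) ∧
      HasSubgradient (fun x => g x + (f x : EReal)) (-app L.transpose u) x := by
  obtain ⟨x₀, hx₀, hLx₀⟩ := h_ri
  obtain ⟨a, b, ha, hb⟩ := hx.exists_eq_coe hg hh (intrinsicInterior_subset hx₀)
    (intrinsicInterior_subset hLx₀)
  have hopt : ∀ y : EuclideanSpace ℝ (Fin n), ∀ a' b' : ℝ, g y ≤ a' → h (app L y) ≤ b' →
      f x + a + b ≤ f y + a' + b' := by
    intro y a' b' h1 h2
    have h3 := (hx y).trans (add_le_add (add_le_add_right h1 _) h2)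
    rw [primalObj, ha, hb] at h3
    exact_mod_cast h3
  obtain ⟨l, hl⟩ := exists_nonvertical_support
    (convex_perturbationEpigraph (L := L) hg hh hc) (m := f x + a + b)
    ⟨x, a, app L x, b, ha.le, hb.le, (sub_self _).symm, le_rfl⟩ (by
      rintro t ⟨y, a', w, b', h1, h2, h3, h4⟩
      obtain rfl : w = app L y := (sub_eq_zero.1 h3.symm)
      exact (hopt y a' b' h1 h2).trans h4) (by
      -- For a perturbation `w - Lc`, both `x₀ + δ(x₀ - c)` and `Lx₀ + δ(Lx₀ - w)` stay in the
      -- domains for small `δ`; they realize the perturbation `-δ(w - Lc)`.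
      rintro _ ⟨q, ⟨c, a', w, b', h1, h2, h3, -⟩, rfl⟩
      obtain ⟨δ₁, hδ₁, hC⟩ := exists_add_smul_sub_mem_of_mem_intrinsicInterior hx₀
        (dom_of_le_coe h1)
      obtain ⟨δ₂, hδ₂, hD⟩ := exists_add_smul_sub_mem_of_mem_intrinsicInterior hLx₀
        (dom_of_le_coe h2)
      have hpos : 0 < min δ₁ δ₂ := lt_min hδ₁ hδ₂
      have hδ : 0 < min δ₁ δ₂ / 2 := by positivity
      have hlt : min δ₁ δ₂ / 2 < min δ₁ δ₂ := by linarith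
      obtain ⟨a'', ha''⟩ := hg.exists_eq_coe (hC _ hδ.le (hlt.trans_le (min_le_left _ _)))
      obtain ⟨b'', hb''⟩ := hh.exists_eq_coe (hD _ hδ.le (hlt.trans_le (min_le_right _ _)))
      refine ⟨min δ₁ δ₂ / 2, hδ, ⟨_, _⟩, ⟨_, a'', _, b'', ha''.le, hb''.le, ?_, le_rfl⟩, rfl⟩
      rw [h3, app_add, app_smul, app_sub]
      module)
  let u := (InnerProductSpace.toDual ℝ _).symm (LinearMap.toContinuousLinearMap l)
  have hu : ∀ y, inner ℝ u y = l y := fun y => InnerProductSpace.toDual_symm_apply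
  have key : ∀ (y : EuclideanSpace ℝ (Fin n)) (a' : ℝ) (w : EuclideanSpace ℝ (Fin r)) (b' : ℝ),
      g y = a' → h w = b' → f x + a + b + inner ℝ u (w - app L y) ≤ f y + a' + b' := by
    intro y a' w b' h1 h2
    rw [hu]
    exact hl (w - app L y, f y + a' + b') ⟨y, a', w, b', h1.le, h2.le, rfl, le_rfl⟩
  refine ⟨u, ⟨b, hb, fun w => ?_⟩, ⟨a + f x, ?_, fun y => ?_⟩⟩
  · induction hw : h w using EReal.rec with
    | bot => exact absurd hw (hh.ne_bot w)
    | top => simp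
    | coe s =>
      rw [EReal.coe_le_coe_iff]
      linarith [key x a w s ha hw]
  · simp only [ha, EReal.coe_add]
  · change _ ≤ g y + (f y : EReal)
    induction hw : g y using EReal.rec with
    | bot => exact absurd hw (hg.ne_bot y)
    | top => simp
    | coe s =>
      rw [← EReal.coe_add, EReal.coe_le_coe_iff, inner_neg_left, ← inner_app_right, app_sub]
      have := key y s (app L x) b hw hb
      rw [← neg_sub, inner_neg_right] at this
      linarith

/-- The Karush–Kuhn–Tucker conditions for the pair of dual problems. -/
def IsKKT (f : EuclideanSpace ℝ (Fin n) → ℝ) (g : EuclideanSpace ℝ (Fin n) → EReal)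
    (h : EuclideanSpace ℝ (Fin r) → EReal) (L : Matrix (Fin r) (Fin n) ℝ)
    (u : EuclideanSpace ℝ (Fin r)) (x : EuclideanSpace ℝ (Fin n)) : Prop :=
  HasSubgradient h u (app L x) ∧ HasSubgradient g (-(gradient f x + app L.transpose u)) x

/-- The hypothesis says that `x` minimizes `g + (f + ⟨v, ·⟩)`, whose second summand is
differentiable. -/
theorem HasSubgradient.of_add_smooth (hg : ProperClosedConvex g) (hf : ContDiff ℝ 1 f)
    {v x : EuclideanSpace ℝ (Fin n)} (hv : HasSubgradient (fun x => g x + (f x : EReal)) (-v) x) :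
    HasSubgradient g (-(gradient f x + v)) x := by
  obtain ⟨c, hc, hv⟩ := hv
  have hq : ∀ e, HasDerivAt (fun t : ℝ => f (x + t • e) + inner ℝ v (x + t • e))
      (inner ℝ (gradient f x + v) e) 0 := by
    intro e
    have h1 := hasDerivAt_line hf x e 0
    have h2 : HasDerivAt (fun t : ℝ => inner ℝ v (x + t • e)) (inner ℝ v e) 0 := by
      simp only [inner_add_right, inner_smul_right]
      simpa using ((hasDerivAt_id (0 : ℝ)).mul_const (inner ℝ v e)).const_add (inner ℝ v x)
    refine (h1.add h2).congr_deriv ?_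
    rw [zero_smul, add_zero, inner_add_left]
  refine hg.hasSubgradient_of_isMin (q := fun w => f w + inner ℝ v w) hq fun w => ?_
  have hw := hv w
  change g x + (f x : EReal) = _ at hc
  change _ ≤ g w + (f w : EReal) at hw
  rw [EReal.coe_add, EReal.coe_add, ← add_assoc, ← add_assoc, hc, ← EReal.coe_add]
  refine le_trans (le_of_eq ?_) (add_le_add_left hw _)
  rw [← EReal.coe_add, EReal.coe_eq_coe_iff, inner_neg_left, inner_sub_right]
  ring

theorem HasSubgradient.add_smooth (hf : ContDiff ℝ 1 f) (hc : ConvexOn ℝ Set.univ f)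
    {v x : EuclideanSpace ℝ (Fin n)} (hv : HasSubgradient g (-(gradient f x + v)) x) :
    HasSubgradient (fun x => g x + (f x : EReal)) (-v) x := by
  obtain ⟨a, ha, hv⟩ := hv
  refine ⟨a + f x, by simp only [ha, EReal.coe_add], fun w => ?_⟩
  refine le_trans ?_ (add_le_add (hv w)
    (EReal.coe_le_coe_iff.2 (add_inner_gradient_le hf hc x w)))
  rw [← EReal.coe_add, EReal.coe_le_coe_iff, inner_neg_left, inner_neg_left, inner_add_left]
  linarith

theorem IsPrimalSolution.exists_isKKT (hg : ProperClosedConvex g) (hh : ProperClosedConvex h)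
    (hf : ContDiff ℝ 1 f) (hc : ConvexOn ℝ Set.univ f)
    (h_ri : ∃ x ∈ intrinsicInterior ℝ (dom g), app L x ∈ intrinsicInterior ℝ (dom h))
    {x : EuclideanSpace ℝ (Fin n)} (hx : IsPrimalSolution f g h L x) :
    ∃ u, IsKKT f g h L u x := by
  obtain ⟨u, h1, h2⟩ := hx.exists_multiplier hg hh hc h_ri
  exact ⟨u, h1, h2.of_add_smooth hg hf⟩

theorem IsKKT.exists_dualObj_eq (hf : ContDiff ℝ 1 f) (hc : ConvexOn ℝ Set.univ f)
    {u : EuclideanSpace ℝ (Fin r)} {x : EuclideanSpace ℝ (Fin n)} (hk : IsKKT f g h L u x) :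
    ∃ a b : ℝ, g x = a ∧ h (app L x) = b ∧ dualObj f g h L u = ((-(f x + a + b) : ℝ) : EReal) := by
  obtain ⟨h1, h2⟩ := hk
  have h3 := h2.add_smooth hf hc
  obtain ⟨b, hb, -⟩ := id h1
  obtain ⟨a, ha, -⟩ := id h2
  refine ⟨a, b, ha, hb, ?_⟩
  have hF : (fun x => g x + (f x : EReal)) x = ((a + f x : ℝ) : EReal) := by
    simp only [ha, EReal.coe_add]
  rw [dualObj, h1.conj_eq hb, h3.conj_eq hF, ← EReal.coe_add, EReal.coe_eq_coe_iff,
    inner_neg_left, inner_app_right]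
  ring

/-- Weak duality: in the sum of two Fenchel–Young inequalities the terms `⟨v, Lx⟩` cancel. -/
theorem neg_le_dualObj {x : EuclideanSpace ℝ (Fin n)} {a b : ℝ} (ha : g x = a)
    (hb : h (app L x) = b) (v : EuclideanSpace ℝ (Fin r)) :
    ((-(f x + a + b) : ℝ) : EReal) ≤ dualObj f g h L v := by
  have hF : (fun x => g x + (f x : EReal)) x = ((a + f x : ℝ) : EReal) := by
    simp only [ha, EReal.coe_add]
  refine le_trans (le_of_eq ?_)
    (add_le_add (le_conj _ hF (-app L.transpose v)) (le_conj h hb v))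
  rw [← EReal.coe_add, EReal.coe_eq_coe_iff, inner_neg_left, inner_app_right]
  ring

theorem IsKKT.isDualSolution (hf : ContDiff ℝ 1 f) (hc : ConvexOn ℝ Set.univ f)
    {u : EuclideanSpace ℝ (Fin r)} {x : EuclideanSpace ℝ (Fin n)} (hk : IsKKT f g h L u x) :
    IsDualSolution f g h L u := by
  obtain ⟨a, b, ha, hb, he⟩ := hk.exists_dualObj_eq hf hc
  intro v
  rw [he]
  exact neg_le_dualObj ha hb v

theorem IsKKT.isPrimalSolution (hf : ContDiff ℝ 1 f) (hc : ConvexOn ℝ Set.univ f)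
    {u : EuclideanSpace ℝ (Fin r)} {x : EuclideanSpace ℝ (Fin n)} (hk : IsKKT f g h L u x) :
    IsPrimalSolution f g h L x := by
  obtain ⟨h1, h2⟩ := hk
  obtain ⟨c, hF, h3⟩ := h2.add_smooth hf hc
  obtain ⟨b, hb, h1⟩ := h1
  intro y
  change g x + (f x : EReal) = c at hF
  have e : ∀ x, primalObj f g h L x = g x + (f x : EReal) + h (app L x) := fun x => by
    rw [primalObj, add_comm (f x : EReal)]
  rw [e, e, hF, hb]
  refine le_trans (le_of_eq ?_) (add_le_add (h3 y) (h1 (app L y)))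
  rw [← EReal.coe_add, ← EReal.coe_add, EReal.coe_eq_coe_iff, inner_neg_left, ← inner_app_right,
    app_sub]
  ring

/-- Splits an equality of sums into two equalities, with infinite values excluded; applied to the
two Fenchel–Young inequalities at an optimal pair. -/
theorem le_and_le_of_add_le_coe {c₁ c₂ : EReal} {a b : ℝ} (h1 : (a : EReal) ≤ c₁)
    (h2 : (b : EReal) ≤ c₂) (hs : c₁ + c₂ ≤ ((a + b : ℝ) : EReal)) : c₁ ≤ a ∧ c₂ ≤ b := by
  induction c₁ using EReal.rec with
  | bot => simp at h1
  | top =>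
    have : c₂ ≠ ⊥ := by rintro rfl; simp at h2
    rw [EReal.top_add_of_ne_bot this, top_le_iff] at hs
    exact absurd hs (EReal.coe_ne_top _)
  | coe s =>
    induction c₂ using EReal.rec with
    | bot => simp at h2
    | top =>
      rw [EReal.coe_add_top, top_le_iff] at hs
      exact absurd hs (EReal.coe_ne_top _)
    | coe t =>
      rw [← EReal.coe_add] at hs
      rw [EReal.coe_le_coe_iff] at h1 h2 hs
      exact ⟨EReal.coe_le_coe_iff.2 (by linarith), EReal.coe_le_coe_iff.2 (by linarith)⟩

/-- The primal-dual solutions are the solutions of the Karush–Kuhn–Tucker conditions. -/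
theorem mem_solutionSet_iff (hg : ProperClosedConvex g) (hh : ProperClosedConvex h)
    (hf : ContDiff ℝ 1 f) (hc : ConvexOn ℝ Set.univ f)
    (h_ri : ∃ x ∈ intrinsicInterior ℝ (dom g), app L x ∈ intrinsicInterior ℝ (dom h))
    (z : PD r n) :
    z ∈ solutionSet f g h L ↔ IsKKT f g h L (dualPart z) (primalPart z) := by
  refine ⟨fun hz => ?_, fun hk => ⟨hk.isDualSolution hf hc, hk.isPrimalSolution hf hc⟩⟩
  obtain ⟨hu, hx⟩ := hz
  generalize dualPart z = u at hu
  generalize primalPart z = x at hx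
  -- The multiplier `u'` need not equal `u`, but it closes the duality gap; since `u` does at least
  -- as well in the dual, both Fenchel–Young inequalities are tight at `(u, x)`.
  obtain ⟨u', hk⟩ := hx.exists_isKKT hg hh hf hc h_ri
  obtain ⟨a, b, ha, hb, he⟩ := hk.exists_dualObj_eq hf hc
  have hle := hu u'
  rw [he, dualObj] at hle
  have hF : (fun x => g x + (f x : EReal)) x = ((a + f x : ℝ) : EReal) := by
    simp only [ha, EReal.coe_add]
  obtain ⟨h1, h2⟩ := le_and_le_of_add_le_coe (le_conj _ hF (-app L.transpose u)) (le_conj h hb u)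
    (hle.trans (le_of_eq (by
      rw [EReal.coe_eq_coe_iff, inner_neg_left, inner_app_right]
      ring)))
  exact ⟨HasSubgradient.of_conj_le hb h2,
    (HasSubgradient.of_conj_le hF h1).of_add_smooth hg hf⟩

end Duality

/-! ### Components of primal-dual vectors -/

section BlockVectors

variable {n r : ℕ}

theorem dualPart_pair (u : EuclideanSpace ℝ (Fin r)) (x : EuclideanSpace ℝ (Fin n)) :
    dualPart (pair u x) = u := rfl

theorem primalPart_pair (u : EuclideanSpace ℝ (Fin r)) (x : EuclideanSpace ℝ (Fin n)) :
    primalPart (pair u x) = x := rfl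

theorem pair_parts (z : PD r n) : pair (dualPart z) (primalPart z) = z := by
  ext i
  cases i <;> rfl

theorem dualPart_sub (z w : PD r n) : dualPart (z - w) = dualPart z - dualPart w := rfl

theorem primalPart_sub (z w : PD r n) : primalPart (z - w) = primalPart z - primalPart w := rfl

theorem inner_eq_add_parts (z w : PD r n) :
    inner ℝ z w = inner ℝ (dualPart z) (dualPart w) + inner ℝ (primalPart z) (primalPart w) := by
  simp [PiLp.inner_apply, Fintype.sum_sum_type, dualPart, primalPart]

theorem dualPart_fromBlocks (A : Matrix (Fin r) (Fin r) ℝ) (B : Matrix (Fin r) (Fin n) ℝ)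
    (C : Matrix (Fin n) (Fin r) ℝ) (D : Matrix (Fin n) (Fin n) ℝ) (z : PD r n) :
    dualPart (app (Matrix.fromBlocks A B C D) z) = app A (dualPart z) + app B (primalPart z) := by
  ext i
  simp [dualPart, primalPart, app_apply, Fintype.sum_sum_type]

theorem primalPart_fromBlocks (A : Matrix (Fin r) (Fin r) ℝ) (B : Matrix (Fin r) (Fin n) ℝ)
    (C : Matrix (Fin n) (Fin r) ℝ) (D : Matrix (Fin n) (Fin n) ℝ) (z : PD r n) :
    primalPart (app (Matrix.fromBlocks A B C D) z)
      = app C (dualPart z) + app D (primalPart z) := by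
  ext i
  simp [dualPart, primalPart, app_apply, Fintype.sum_sum_type]

theorem continuous_dualPart : Continuous (dualPart : PD r n → _) := by
  unfold dualPart; fun_prop

theorem continuous_primalPart : Continuous (primalPart : PD r n → _) := by
  unfold primalPart; fun_prop

theorem continuous_pair :
    Continuous fun p : EuclideanSpace ℝ (Fin r) × EuclideanSpace ℝ (Fin n) => pair p.1 p.2 := by
  unfold pair
  refine (PiLp.continuous_toLp 2 _).comp (continuous_pi fun i => ?_)
  cases i <;> simp only [Sum.elim_inl, Sum.elim_inr] <;> fun_prop

end BlockVectors

/-! ### The operator `T`: fixed points, continuity and the descent inequality -/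

section Operator

variable {n r : ℕ} {f : EuclideanSpace ℝ (Fin n) → ℝ} {g : EuclideanSpace ℝ (Fin n) → EReal}
  {h : EuclideanSpace ℝ (Fin r) → EReal} {L : Matrix (Fin r) (Fin n) ℝ}
  {Q : Matrix (Fin n) (Fin n) ℝ} {β : ℝ}
  {Sg : Matrix (Fin r) (Fin r) ℝ} {Gm : Matrix (Fin n) (Fin n) ℝ}

/-- The matrix `2 P̃ - S` in block form. -/
theorem two_matPtilde_sub_matS : (2 : ℝ) • matPtilde L Sg Gm Q β - matS Sg Gm
    = Matrix.fromBlocks Sg⁻¹ (-L) (-L.transpose) (Gm⁻¹ - (β / 2) • Q) := by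
  ext i j
  rcases i with i | i <;> rcases j with j | j <;> simp [matPtilde, matS] <;> ring

theorem normSqW_two_matPtilde_sub_matS (d : PD r n) :
    normSqW ((2 : ℝ) • matPtilde L Sg Gm Q β - matS Sg Gm) d
      = normSqW Sg⁻¹ (dualPart d) - 2 * inner ℝ (dualPart d) (app L (primalPart d))
        + normSqW Gm⁻¹ (primalPart d) - β / 2 * normSqW Q (primalPart d) := by
  rw [two_matPtilde_sub_matS, normSqW, inner_eq_add_parts, dualPart_fromBlocks,
    primalPart_fromBlocks, matrix_sub_app, matrix_smul_app]
  have e1 : app (-L) (primalPart d) = -app L (primalPart d) := by simp [app]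
  have e2 : app (-L.transpose) (dualPart d) = -app L.transpose (dualPart d) := by simp [app]
  rw [e1, e2]
  simp only [inner_add_right, inner_neg_right, inner_sub_right, inner_smul_right, normSqW,
    inner_app_right L.transpose, Matrix.transpose_transpose]
  rw [real_inner_comm (app L (primalPart d))]
  ring

theorem inner_matS (z w : PD r n) : inner ℝ (app (matS Sg Gm) z) w
    = inner ℝ (app Sg⁻¹ (dualPart z)) (dualPart w)
      + inner ℝ (app Gm⁻¹ (primalPart z)) (primalPart w) := by
  rw [inner_eq_add_parts, matS, dualPart_fromBlocks, primalPart_fromBlocks]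
  have e1 : app (0 : Matrix (Fin r) (Fin n) ℝ) (primalPart z) = 0 := by simp [app]
  have e2 : app (0 : Matrix (Fin n) (Fin r) ℝ) (dualPart z) = 0 := by simp [app]
  rw [e1, e2, add_zero, zero_add]

theorem normSqW_matS (z : PD r n) : normSqW (matS Sg Gm) z
    = normSqW Sg⁻¹ (dualPart z) + normSqW Gm⁻¹ (primalPart z) := by
  rw [normSqW, real_inner_comm, inner_matS, real_inner_comm, real_inner_comm (primalPart z)]
  rfl

/-- The Schur complement argument for `2 P̃ - S`. -/
theorem normSqW_two_matPtilde_sub_matS_eq_add (hSg : Sg.PosDef) (d : PD r n) :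
    normSqW ((2 : ℝ) • matPtilde L Sg Gm Q β - matS Sg Gm) d
      = normSqW Sg⁻¹ (dualPart d - app Sg (app L (primalPart d)))
        + normSqW (Gm⁻¹ - (β / 2) • Q - L.transpose * Sg * L) (primalPart d) := by
  -- Completing the square in the dual variable; the reference point `0` makes this the plain
  -- expansion of `‖u - Σ L x‖²` in the norm of `Σ⁻¹`.
  rw [normSqW_two_matPtilde_sub_matS, normSqW_sub_eq hSg.inv _ 0]
  simp only [sub_zero]
  have e1 : inner ℝ (app Sg⁻¹ (dualPart d)) (app Sg (app L (primalPart d)))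
      = inner ℝ (dualPart d) (app L (primalPart d)) := by
    rw [hSg.inv.inner_app, hSg.app_inv_app]
  have e2 : normSqW Sg⁻¹ (app Sg (app L (primalPart d)))
      = inner ℝ (primalPart d) (app (L.transpose * Sg * L) (primalPart d)) := by
    rw [normSqW, hSg.app_inv_app, Matrix.mul_assoc, ← app_app, inner_app_right L.transpose,
      Matrix.transpose_transpose, ← app_app, hSg.inner_app]
  rw [e1, e2, normSqW, normSqW, normSqW, normSqW, matrix_sub_app, matrix_sub_app, matrix_smul_app]
  simp only [inner_sub_right, inner_smul_right]
  ring

theorem posDef_normSqW_two_matPtilde_sub_matS (hSg : Sg.PosDef)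
    (h_step : (Gm⁻¹ - (β / 2) • Q - L.transpose * Sg * L).PosDef) :
    (∀ d : PD r n, 0 ≤ normSqW ((2 : ℝ) • matPtilde L Sg Gm Q β - matS Sg Gm) d) ∧
    ∀ d : PD r n, normSqW ((2 : ℝ) • matPtilde L Sg Gm Q β - matS Sg Gm) d = 0 → d = 0 := by
  refine ⟨fun d => ?_, fun d hd => ?_⟩
  · rw [normSqW_two_matPtilde_sub_matS_eq_add hSg]
    exact add_nonneg (normSqW_nonneg hSg.inv _) (normSqW_nonneg h_step _)
  · rw [normSqW_two_matPtilde_sub_matS_eq_add hSg] at hd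
    have h1 := normSqW_nonneg hSg.inv (dualPart d - app Sg (app L (primalPart d)))
    have h2 := normSqW_nonneg h_step (primalPart d)
    have hx : primalPart d = 0 := by
      by_contra hne
      linarith [normSqW_pos h_step hne]
    have hu : dualPart d - app Sg (app L (primalPart d)) = 0 := by
      by_contra hne
      linarith [normSqW_pos hSg.inv hne]
    rw [hx, app_zero, app_zero, sub_zero] at hu
    rw [← pair_parts d, hu, hx]
    ext i
    cases i <;> rfl

variable (f g h L Sg Gm) in
/-- The intermediate dual vector `ū` of the operator `T`. -/
def dualStep (z : PD r n) : EuclideanSpace ℝ (Fin r) :=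
  prox Sg⁻¹ (conj h) (dualPart z + app Sg (app L (primalPart z)))

variable (f g h L Sg Gm) in
/-- The primal vector `x̄` of the operator `T`. -/
def primalStep (z : PD r n) : EuclideanSpace ℝ (Fin n) :=
  prox Gm⁻¹ g (primalPart z - app Gm (gradient f (primalPart z))
    - app Gm (app L.transpose (dualStep h L Sg z)))

theorem opT_eq (z : PD r n) : opT f g h L Sg Gm z
    = pair (dualStep h L Sg z + app Sg (app L (primalStep f g h L Sg Gm z - primalPart z)))
        (primalStep f g h L Sg Gm z) := rfl

theorem continuous_opT (hg : ProperClosedConvex g) (hh : ProperClosedConvex h)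
    (hf : ContDiff ℝ 1 f) (hSg : Sg.PosDef) (hGm : Gm.PosDef) :
    Continuous (opT f g h L Sg Gm) := by
  have hx := continuous_primalPart (r := r) (n := n)
  have h1 : Continuous (dualStep (n := n) h L Sg) :=
    (continuous_prox_conj hh hSg).comp
      (continuous_dualPart.add ((continuous_app Sg).comp ((continuous_app L).comp hx)))
  have h2 : Continuous (primalStep f g h L Sg Gm) :=
    (continuous_prox hg hGm.inv).comp
      ((hx.sub ((continuous_app Gm).comp ((continuous_gradient hf).comp hx))).sub
        ((continuous_app Gm).comp ((continuous_app L.transpose).comp h1)))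
  rw [funext opT_eq]
  exact continuous_pair.comp ((h1.add ((continuous_app Sg).comp
    ((continuous_app L).comp (h2.sub hx)))).prodMk h2)

theorem hasSubgradient_dualStep (hh : ProperClosedConvex h) (hSg : Sg.PosDef) (z : PD r n) :
    HasSubgradient h (dualStep h L Sg z)
      (app Sg⁻¹ (dualPart z - dualStep h L Sg z) + app L (primalPart z)) := by
  have h1 := hasSubgradient_prox_conj hh hSg (dualPart z + app Sg (app L (primalPart z)))
  rwa [add_sub_right_comm, app_add, hSg.app_inv_app] at h1

theorem hasSubgradient_primalStep (hg : ProperClosedConvex g) (hGm : Gm.PosDef) (z : PD r n) :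
    HasSubgradient g (app Gm⁻¹ (primalPart z - primalStep f g h L Sg Gm z)
      - gradient f (primalPart z) - app L.transpose (dualStep h L Sg z))
      (primalStep f g h L Sg Gm z) := by
  have h1 := hasSubgradient_prox hg hGm.inv (primalPart z - app Gm (gradient f (primalPart z))
    - app Gm (app L.transpose (dualStep h L Sg z)))
  simp only [app_sub, hGm.app_inv_app] at h1
  have e : app Gm⁻¹ (primalPart z - primalStep f g h L Sg Gm z)
      - gradient f (primalPart z) - app L.transpose (dualStep h L Sg z)
      = app Gm⁻¹ (primalPart z) - gradient f (primalPart z)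
        - app L.transpose (dualStep h L Sg z) - app Gm⁻¹ (primalStep f g h L Sg Gm z) := by
    rw [app_sub]; abel
  rw [e]
  exact h1

/-- The fixed points of `T` are solutions of the Karush–Kuhn–Tucker conditions. -/
theorem isKKT_of_opT_eq (hg : ProperClosedConvex g) (hh : ProperClosedConvex h)
    (hSg : Sg.PosDef) (hGm : Gm.PosDef) {z : PD r n} (hz : opT f g h L Sg Gm z = z) :
    IsKKT f g h L (dualPart z) (primalPart z) := by
  have hx : primalStep f g h L Sg Gm z = primalPart z := by
    conv_rhs => rw [← hz, opT_eq, primalPart_pair]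
  have hu : dualStep h L Sg z = dualPart z := by
    conv_rhs => rw [← hz, opT_eq, dualPart_pair, hx, sub_self, app_zero, app_zero, add_zero]
  have h1 := hasSubgradient_dualStep (L := L) hh hSg z
  have h2 := hasSubgradient_primalStep (f := f) (h := h) (L := L) (Sg := Sg) hg hGm z
  rw [hu, sub_self, app_zero, zero_add] at h1
  rw [hu, hx, sub_self, app_zero, zero_sub, ← neg_add'] at h2
  exact ⟨h1, h2⟩

/-- The basic contraction inequality of the operator `T`. -/
theorem two_inner_matS_add_le (hg : ProperClosedConvex g) (hh : ProperClosedConvex h)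
    (hf : ContDiff ℝ 1 f) (hc : ConvexOn ℝ Set.univ f) (hQ : Q.PosDef)
    (hlip : ∀ x y, normW Q⁻¹ (gradient f x - gradient f y) ≤ β * normW Q (x - y))
    (hSg : Sg.PosDef) (hGm : Gm.PosDef) {zs : PD r n}
    (hzs : IsKKT f g h L (dualPart zs) (primalPart zs)) (z : PD r n) :
    2 * inner ℝ (app (matS Sg Gm) (opT f g h L Sg Gm z - z)) (z - zs)
        + normSqW (matS Sg Gm) (opT f g h L Sg Gm z - z)
      ≤ -normSqW ((2 : ℝ) • matPtilde L Sg Gm Q β - matS Sg Gm) (opT f g h L Sg Gm z - z) := by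
  have h1 := (hasSubgradient_dualStep (L := L) hh hSg z).inner_nonneg hzs.1
  have h2 := (hasSubgradient_primalStep (f := f) (h := h) (L := L) (Sg := Sg) hg hGm z).inner_nonneg
    hzs.2
  have h3 := neg_quarter_le_inner_gradient_sub hf hc hQ hlip (primalPart z) (primalPart zs)
    (primalStep f g h L Sg Gm z)
  rw [normSqW_two_matPtilde_sub_matS, inner_matS, normSqW_matS]
  simp only [dualPart_sub, primalPart_sub, opT_eq, dualPart_pair, primalPart_pair]
  generalize dualPart z = u at *
  generalize primalPart z = x at *
  generalize dualPart zs = us at *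
  generalize primalPart zs = xs at *
  generalize dualStep h L Sg z = ub at *
  generalize primalStep f g h L Sg Gm z = xb at *
  -- In the new variables `Tz - z = (d, e)`.
  obtain ⟨e, rfl⟩ : ∃ e, xb = x + e := ⟨xb - x, by abel⟩
  rw [add_sub_cancel_left] at *
  obtain ⟨d, rfl⟩ : ∃ d, u = ub + app Sg (app L e) - d :=
    ⟨ub + app Sg (app L e) - u, by abel⟩
  -- The correction in `T` replaces `L x` by `L x̄` here, so `⟨ū - u*, L(x̄ - x*)⟩` occurs with
  -- opposite signs in the dual and primal monotonicity inequalities.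
  have e1 : app Sg⁻¹ (ub + app Sg (app L e) - d - ub) + app L x - app L xs
      = app L (x + e - xs) - app Sg⁻¹ d := by
    have : ub + app Sg (app L e) - d - ub = app Sg (app L e) - d := by abel
    rw [this, app_sub, hSg.app_inv_app, app_sub, app_add]
    abel
  have e2 : app Gm⁻¹ (x - (x + e)) - gradient f x - app L.transpose ub
      - -(gradient f xs + app L.transpose us)
      = -app Gm⁻¹ e - (gradient f x - gradient f xs) - app L.transpose (ub - us) := by
    have : x - (x + e) = -e := by abel
    rw [this, app_neg, app_sub]
    abel
  have e3 : ub + app Sg (app L e) - d - us = (ub - us) + app Sg (app L e) - d := by abel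
  have e4 : x - xs = (x + e - xs) - e := by abel
  have e5 : inner ℝ (app Sg⁻¹ d) (app Sg (app L e)) = inner ℝ d (app L e) := by
    rw [hSg.inv.inner_app, hSg.app_inv_app]
  have e6 : ub + app Sg (app L e) - (ub + app Sg (app L e) - d) = d := by abel
  rw [e1, inner_sub_right] at h1
  rw [e2, inner_sub_left, inner_sub_left, inner_neg_left, ← inner_app_right] at h2
  rw [e6, e3, e4, inner_sub_right _ _ d, inner_add_right, e5, inner_sub_right _ _ e]
  have e7 : inner ℝ (app Sg⁻¹ d) d = normSqW Sg⁻¹ d := real_inner_comm _ _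
  have e8 : inner ℝ (app Gm⁻¹ e) e = normSqW Gm⁻¹ e := real_inner_comm _ _
  rw [e7, e8]
  have e9 : inner ℝ (ub - us) (app Sg⁻¹ d) = inner ℝ (app Sg⁻¹ d) (ub - us) :=
    real_inner_comm _ _
  linarith

end Operator

/-! ### Almost sure convergence of nonnegative almost-supermartingales -/

section SupermartingaleConvergence

variable {Ω : Type*} {mΩ : MeasurableSpace Ω} {μ : Measure Ω} [IsProbabilityMeasure μ]
  {ℱ : Filtration ℕ mΩ}

/-- A nonnegative supermartingale converges almost surely. -/
theorem _root_.MeasureTheory.Supermartingale.exists_ae_tendsto_of_nonneg {X : ℕ → Ω → ℝ}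
    (hX : Supermartingale X ℱ μ) (h0 : ∀ k ω, 0 ≤ X k ω) :
    ∀ᵐ ω ∂μ, ∃ c, Tendsto (fun k => X k ω) atTop (𝓝 c) := by
  have hbdd : ∀ k, eLpNorm ((-X) k) 1 μ ≤ ((∫ ω, X 0 ω ∂μ).toNNReal : ENNReal) := by
    intro k
    have h1 : ∫ ω, X k ω ∂μ ≤ ∫ ω, X 0 ω ∂μ := by
      simpa using hX.setIntegral_le (Nat.zero_le k) MeasurableSet.univ
    rw [eLpNorm_one_eq_lintegral_enorm, ← ofReal_integral_norm_eq_lintegral_enorm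
      (hX.neg.integrable k)]
    refine ENNReal.ofReal_le_ofReal (le_trans (le_of_eq ?_) h1)
    refine integral_congr_ae (Eventually.of_forall fun ω => ?_)
    simp [abs_of_nonneg (h0 k ω)]
  filter_upwards [hX.neg.exists_ae_tendsto_of_bdd hbdd] with ω ⟨c, hc⟩
  exact ⟨-c, by simpa using hc.neg⟩

/-- A special case of the Robbins–Siegmund theorem. -/
theorem ae_tendsto_of_condExp_le_sub {X Y : ℕ → Ω → ℝ} (hX0 : ∀ k ω, 0 ≤ X k ω)
    (hY0 : ∀ k ω, 0 ≤ Y k ω) (hXm : ∀ k, StronglyMeasurable[ℱ k] (X k))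
    (hYm : ∀ k, StronglyMeasurable[ℱ k] (Y k)) (hXi : ∀ k, Integrable (X k) μ)
    (hYi : ∀ k, Integrable (Y k) μ)
    (h : ∀ k, μ[X (k + 1) | ℱ k] ≤ᵐ[μ] fun ω => X k ω - Y k ω) :
    ∀ᵐ ω ∂μ, (∃ c, Tendsto (fun k => X k ω) atTop (𝓝 c)) ∧
      Tendsto (fun k => Y k ω) atTop (𝓝 0) := by
  have hXs : Supermartingale X ℱ μ := by
    refine supermartingale_nat hXm hXi fun k => (h k).trans (Eventually.of_forall fun ω => ?_)
    have := hY0 k ω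
    simp only
    linarith
  have hsm : ∀ k, StronglyMeasurable[ℱ k] (∑ j ∈ Finset.range (k + 1), Y j) := fun k =>
    Finset.stronglyMeasurable_sum _ fun j hj =>
      (hYm j).mono (ℱ.mono (Nat.lt_succ_iff.1 (Finset.mem_range.1 hj)))
  have hsm' : ∀ k, StronglyMeasurable[ℱ k] (∑ j ∈ Finset.range k, Y j) := fun k =>
    Finset.stronglyMeasurable_sum _ fun j hj =>
      (hYm j).mono (ℱ.mono (Finset.mem_range.1 hj).le)
  have hsi : ∀ k, Integrable (∑ j ∈ Finset.range k, Y j) μ := fun k =>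
    integrable_finsetSum' _ fun j _ => hYi j
  -- `X k + ∑_{j<k} Y j` is again a nonnegative supermartingale: the sum up to `k` is known at time
  -- `k` and absorbs the decrease. Both processes converge, hence so do the partial sums, and `Y k →
  -- 0`.
  have hWs : Supermartingale (fun k => X k + ∑ j ∈ Finset.range k, Y j) ℱ μ := by
    refine supermartingale_nat (fun k => (hXm k).add (hsm' k)) (fun k => (hXi k).add (hsi k))
      fun k => ?_
    have h1 := condExp_add (hXi (k + 1)) (hsi (k + 1)) (ℱ k)
    rw [condExp_of_stronglyMeasurable (ℱ.le k) (hsm k) (hsi (k + 1))] at h1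
    filter_upwards [h1, h k] with ω h1 h2
    rw [h1, Pi.add_apply, Pi.add_apply, Finset.sum_range_succ, Pi.add_apply]
    linarith
  filter_upwards [hXs.exists_ae_tendsto_of_nonneg hX0, hWs.exists_ae_tendsto_of_nonneg
    (fun k ω => by
      rw [Pi.add_apply, Finset.sum_apply]
      exact add_nonneg (hX0 k ω) (Finset.sum_nonneg fun j _ => hY0 j ω))] with ω ⟨c, hc⟩ ⟨c', hc'⟩
  refine ⟨⟨c, hc⟩, ?_⟩
  have hs := hc'.sub hc
  have hs' := ((tendsto_add_atTop_iff_nat 1).2 hs).sub hs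
  rw [sub_self] at hs'
  refine hs'.congr fun k => ?_
  simp [Finset.sum_range_succ]

end SupermartingaleConvergence

/-- A sequence that is Fejér monotone in the limit with respect to a set containing the fixed
points of a continuous map, and whose displacement vanishes, converges to a point of the set. -/
theorem exists_tendsto_of_quasiFejer {E : Type*} [NormedAddCommGroup E] [ProperSpace E]
    {T : E → E} (hT : Continuous T) {S D : Set E} (hTS : ∀ x, T x = x → x ∈ S) (hS : S.Nonempty)
    (hD : S ⊆ closure D) {q N : E → ℝ} (hq : Continuous q) (hq0 : ∀ d, q d = 0 → d = 0)
    (hN : Continuous N) (hN0 : N 0 = 0) {c : ℝ} (hc : 0 < c) (hcN : ∀ v, c * ‖v‖ ^ 2 ≤ N v)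
    {z : ℕ → E} (hz : ∀ s ∈ D, ∃ l, Tendsto (fun k => N (z k - s)) atTop (𝓝 l))
    (hqz : Tendsto (fun k => q (T (z k) - z k)) atTop (𝓝 0)) :
    ∃ x ∈ S, Tendsto z atTop (𝓝 x) := by
  have hDne : D.Nonempty := closure_nonempty_iff.1 (hS.mono hD)
  obtain ⟨s₀, hs₀⟩ := hDne
  obtain ⟨l₀, hl₀⟩ := hz s₀ hs₀
  obtain ⟨B, hB⟩ := hl₀.bddAbove_range
  have hbd : ∀ k, z k ∈ Metric.closedBall s₀ (Real.sqrt (B / c)) := by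
    intro k
    rw [Metric.mem_closedBall, dist_eq_norm]
    refine Real.le_sqrt_of_sq_le ?_
    rw [le_div_iff₀ hc, mul_comm]
    exact (hcN _).trans (hB ⟨k, rfl⟩)
  -- A cluster point `x` lies in `S` since `q (T x - x) = 0`, but perhaps not in `D`. A nearby `s ∈
  -- D` replaces it: `N (z k - s)` converges to the small number `N (x - s)` along the whole
  -- sequence.
  obtain ⟨x, -, φ, hφ, hx⟩ := tendsto_subseq_of_bounded Metric.isBounded_closedBall hbd
  have hqx : q (T x - x) = 0 := by
    have h1 : Tendsto (fun k => q (T (z (φ k)) - z (φ k))) atTop (𝓝 (q (T x - x))) :=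
      ((hq.comp (hT.sub continuous_id)).tendsto x).comp hx
    exact tendsto_nhds_unique h1 (hqz.comp hφ.tendsto_atTop)
  have hxS : x ∈ S := hTS x (sub_eq_zero.1 (hq0 _ hqx))
  refine ⟨x, hxS, Metric.tendsto_atTop.2 fun η hη => ?_⟩
  have hopen : IsOpen {v : E | N (x - v) < c * (η / 2) ^ 2} :=
    isOpen_lt (hN.comp (continuous_const.sub continuous_id)) continuous_const
  have hopen2 : x ∈ {v : E | N (x - v) < c * (η / 2) ^ 2} := by
    rw [Set.mem_ofPred_eq, sub_self, hN0]
    positivity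
  obtain ⟨s, hs, hsD⟩ := mem_closure_iff.1 (hD hxS) _ hopen hopen2
  have hlt : ∀ v, N v < c * (η / 2) ^ 2 → ‖v‖ < η / 2 := fun v hv =>
    lt_of_pow_lt_pow_left₀ 2 (by positivity) (lt_of_mul_lt_mul_left ((hcN v).trans_lt hv) hc.le)
  obtain ⟨l, hl⟩ := hz s hsD
  have h1 : Tendsto (fun k => N (z (φ k) - s)) atTop (𝓝 (N (x - s))) :=
    ((hN.comp (continuous_id.sub continuous_const)).tendsto x).comp hx
  rw [tendsto_nhds_unique (hl.comp hφ.tendsto_atTop) h1] at hl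
  obtain ⟨k₀, hk₀⟩ := eventually_atTop.1 (hl.eventually_lt_const hs)
  refine ⟨k₀, fun k hk => ?_⟩
  have h2 := hlt _ (hk₀ k hk)
  have h3 := hlt _ hs
  rw [dist_eq_norm]
  have h4 := norm_sub_le_norm_sub_add_norm_sub (z k) s x
  rw [norm_sub_rev s x] at h4
  linarith

/-! ### Activation vectors: filtration, independence and conditional means -/

section Activation

variable {m : ℕ} {Ω : Type*} {mΩ : MeasurableSpace Ω} {μ : Measure Ω}
  {ε : ℕ → Ω → Fin m → Bool}

theorem measurable_history (ε : ℕ → Ω → Fin m → Bool) {j k : ℕ} (hjk : j < k) :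
    Measurable[history ε k] (ε j) := by
  rw [measurable_iff_comap_le]
  exact le_iSup (fun j : Fin k => MeasurableSpace.comap (ε j) inferInstance) ⟨j, hjk⟩

theorem history_le (hε : ∀ k, Measurable (ε k)) (k : ℕ) : history ε k ≤ mΩ :=
  iSup_le fun j => (hε j).comap_le

theorem history_mono (ε : ℕ → Ω → Fin m → Bool) {k l : ℕ} (hkl : k ≤ l) :
    history ε k ≤ history ε l :=
  iSup_le fun j => measurable_iff_comap_le.1 (measurable_history ε (j.2.trans_le hkl))

/-- The filtration generated by the activation vectors. -/
def historyFiltration (hε : ∀ k, Measurable (ε k)) : Filtration ℕ mΩ where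
  seq := history ε
  mono' _ _ h := history_mono ε h
  le' := history_le hε

theorem indep_history (hε : ∀ k, Measurable (ε k)) (hind : iIndepFun ε μ) (k : ℕ) :
    Indep (MeasurableSpace.comap (ε k) inferInstance) (history ε k) μ := by
  -- `history ε k` involves only the indices below `k`, a set disjoint from `{k}`.
  have h := indep_iSup_of_disjoint (fun j => (hε j).comap_le) hind
    (S := {k}) (T := Set.Iio k) (by simp)
  refine indep_of_indep_of_le_left (indep_of_indep_of_le_right h ?_) ?_
  · exact iSup_le fun j => le_iSup₂_of_le (j : ℕ) j.2 le_rfl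
  · exact le_iSup₂_of_le k rfl le_rfl

theorem measurable_ite_bool (i : Fin m) :
    Measurable fun e : Fin m → Bool => if e i then (1 : ℝ) else 0 :=
  measurable_of_countable _

theorem integrable_activation [IsProbabilityMeasure μ] (hε : ∀ k, Measurable (ε k)) (k : ℕ)
    (i : Fin m) : Integrable (fun ω => if ε k ω i then (1 : ℝ) else 0) μ :=
  Integrable.of_bound ((measurable_ite_bool i).comp (hε k)).aestronglyMeasurable 1
    (Eventually.of_forall fun ω => by split_ifs <;> simp)

theorem integral_activation (hε : ∀ k, Measurable (ε k))
    (hid : ∀ k, IdentDistrib (ε k) (ε 0) μ μ) (k : ℕ) (i : Fin m) :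
    ∫ ω, (if ε k ω i then (1 : ℝ) else 0) ∂μ = actProb μ ε i := by
  have h1 := ((hid k).comp (measurable_ite_bool i)).integral_eq
  refine h1.trans ?_
  have hs : MeasurableSet {ω | ε 0 ω i = true} :=
    (hε 0) (Set.to_countable {e : Fin m → Bool | e i = true}).measurableSet
  rw [actProb, ← integral_indicator_one hs]
  refine integral_congr_ae (Eventually.of_forall fun ω => ?_)
  simp [Set.indicator]

/-- Given the past, an activation indicator is independent of a function of the past. -/
theorem condExp_activation_mul [IsProbabilityMeasure μ] (hε : ∀ k, Measurable (ε k))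
    (hind : iIndepFun ε μ) (hid : ∀ k, IdentDistrib (ε k) (ε 0) μ μ) (k : ℕ) (i : Fin m)
    {Y : Ω → ℝ} (hY : StronglyMeasurable[history ε k] Y) {C : ℝ} (hC : ∀ ω, ‖Y ω‖ ≤ C) :
    μ[fun ω => Y ω * (if ε k ω i then (1 : ℝ) else 0) | history ε k]
      =ᵐ[μ] fun ω => Y ω * actProb μ ε i := by
  have h1 := condExp_stronglyMeasurable_mul_of_bound (history_le hε k) hY
    (integrable_activation (μ := μ) hε k i) C (Eventually.of_forall hC)
  have h2 : μ[fun ω => if ε k ω i then (1 : ℝ) else 0 | history ε k] =ᵐ[μ]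
      fun _ => ∫ ω, (if ε k ω i then (1 : ℝ) else 0) ∂μ :=
    condExp_indep_eq (hε k).comap_le (history_le hε k)
      ((measurable_ite_bool i).comp (comap_measurable (ε k))).stronglyMeasurable
      (indep_history hε hind k)
  rw [integral_activation hε hid] at h2
  refine h1.trans ?_
  filter_upwards [h2] with ω h2
  rw [Pi.mul_apply, h2]

end Activation

/-! ### Diagonal weights -/

section DiagonalMatrices

variable {ι : Type} [Fintype ι] [DecidableEq ι]

theorem app_diagonal (d : ι → ℝ) (v : EuclideanSpace ℝ ι) (j : ι) :
    app (Matrix.diagonal d) v j = d j * v j := by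
  rw [app_apply, Finset.sum_eq_single j] <;> simp +contextual [eq_comm]

theorem inner_diagonal (d : ι → ℝ) (v w : EuclideanSpace ℝ ι) :
    inner ℝ (app (Matrix.diagonal d) v) w = ∑ j, d j * v j * w j := by
  simp only [PiLp.inner_apply, app_diagonal, RCLike.inner_apply, conj_trivial]
  exact Finset.sum_congr rfl fun _ _ => by ring

theorem normSqW_diagonal (d : ι → ℝ) (v : EuclideanSpace ℝ ι) :
    normSqW (Matrix.diagonal d) v = ∑ j, d j * v j ^ 2 := by
  rw [normSqW, real_inner_comm, inner_diagonal]
  exact Finset.sum_congr rfl fun _ _ => by ring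

theorem inv_diagonal_of_pos {d : ι → ℝ} (hd : ∀ j, 0 < d j) :
    (Matrix.diagonal d)⁻¹ = Matrix.diagonal fun j => (d j)⁻¹ := by
  refine Matrix.inv_eq_right_inv ?_
  rw [Matrix.diagonal_mul_diagonal, ← Matrix.diagonal_one]
  congr 1
  funext j
  exact mul_inv_cancel₀ (hd j).ne'

theorem exists_diagonal_of_posDef {A : Matrix ι ι ℝ} (hA : A.PosDef) (hd : A.IsDiag) :
    ∃ d : ι → ℝ, (∀ j, 0 < d j) ∧ A⁻¹ = Matrix.diagonal d := by
  have h1 : Matrix.diagonal A.diag = A := hd.diagonal_diag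
  have hpos : ∀ j, 0 < A.diag j := fun j => hA.diag_pos
  refine ⟨fun j => (A.diag j)⁻¹, fun j => inv_pos.2 (hpos j), ?_⟩
  rw [← inv_diagonal_of_pos hpos, h1]

theorem exists_matS_eq_diagonal {n r : ℕ} {Sg : Matrix (Fin r) (Fin r) ℝ}
    {Gm : Matrix (Fin n) (Fin n) ℝ} (hSg : Sg.PosDef) (hGm : Gm.PosDef) (hSg_diag : Sg.IsDiag)
    (hGm_diag : Gm.IsDiag) :
    ∃ s : Fin r ⊕ Fin n → ℝ, (∀ j, 0 < s j) ∧ matS Sg Gm = Matrix.diagonal s := by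
  obtain ⟨a, ha, hSa⟩ := exists_diagonal_of_posDef hSg hSg_diag
  obtain ⟨b, hb, hGb⟩ := exists_diagonal_of_posDef hGm hGm_diag
  refine ⟨Sum.elim a b, fun j => by cases j <;> simp [ha, hb], ?_⟩
  rw [matS, hSa, hGb, Matrix.fromBlocks_diagonal]

end DiagonalMatrices

/-! ### Block-coordinate iterates and their conditional expectation -/

section BlockIterates

variable {n r m : ℕ}

/-- Diagonal `0/1` matrices that add up to the identity partition the coordinates. -/
theorem exists_block_map {ι : Type} [Fintype ι] [DecidableEq ι] {U : Fin m → Matrix ι ι ℝ}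
    (hU_diag : ∀ i, (U i).IsDiag) (hU_01 : ∀ i j, U i j j = 0 ∨ U i j j = 1)
    (hU_sum : ∑ i, U i = 1) :
    ∃ blk : ι → Fin m, ∀ i, U i = Matrix.diagonal fun j => if i = blk j then 1 else 0 := by
  have h1 : ∀ j, ∑ i, U i j j = 1 := fun j => by
    rw [← Matrix.sum_apply, hU_sum, Matrix.one_apply_eq]
  have h2 : ∀ j, ∃ i₀, ∀ i, U i j j = if i = i₀ then 1 else 0 := by
    intro j
    -- Entries in `{0, 1}` with sum one: exactly one of them equals one.
    have hne : ∃ i₀, U i₀ j j = 1 := by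
      by_contra hn
      push Not at hn
      have : ∑ i, U i j j = 0 :=
        Finset.sum_eq_zero fun i _ => (hU_01 i j).resolve_right (hn i)
      rw [h1] at this
      exact one_ne_zero this
    obtain ⟨i₀, hi₀⟩ := hne
    refine ⟨i₀, fun i => ?_⟩
    split_ifs with hi
    · rw [hi, hi₀]
    · have h3 := h1 j
      rw [← Finset.add_sum_erase _ _ (Finset.mem_univ i₀), hi₀, add_eq_left] at h3
      refine (Finset.sum_eq_zero_iff_of_nonneg fun i _ => ?_).1 h3 i
        (Finset.mem_erase.2 ⟨hi, Finset.mem_univ i⟩)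
      rcases hU_01 i j with h | h <;> simp [h]
  choose blk hblk using h2
  refine ⟨blk, fun i => ?_⟩
  rw [← (hU_diag i).diagonal_diag]
  congr 1
  funext j
  exact hblk j i

variable {T : PD r n → PD r n} {U : Fin m → Matrix (Fin r ⊕ Fin n) (Fin r ⊕ Fin n) ℝ}
  {blk : Fin r ⊕ Fin n → Fin m}

theorem opThat_apply (hU : ∀ i, U i = Matrix.diagonal fun j => if i = blk j then 1 else 0)
    (e : Fin m → Bool) (z : PD r n) (j : Fin r ⊕ Fin n) :
    opThat T U e z j = z j + (if e (blk j) then 1 else 0) * (T z - z) j := by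
  simp only [opThat, hU, PiLp.add_apply, WithLp.ofLp_sum, Finset.sum_apply, PiLp.smul_apply,
    app_diagonal, smul_eq_mul]
  congr 1
  rw [Finset.sum_eq_single (blk j)] <;> simp +contextual

theorem probMat_eq_diagonal (hU : ∀ i, U i = Matrix.diagonal fun j => if i = blk j then 1 else 0)
    (p : Fin m → ℝ) : probMat p U = Matrix.diagonal fun j => p (blk j) := by
  ext i j
  simp only [probMat, hU, Matrix.sum_apply, Matrix.smul_apply, smul_eq_mul, Matrix.diagonal_apply]
  by_cases hij : i = j <;> simp [hij]

variable {Ω : Type*} {mΩ : MeasurableSpace Ω} {ε : ℕ → Ω → Fin m → Bool} {z0 : PD r n}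

theorem continuous_opThat (hT : Continuous T) (e : Fin m → Bool) : Continuous (opThat T U e) := by
  unfold opThat
  refine continuous_id.add (continuous_finsetSum _ fun i _ => ?_)
  exact ((continuous_app (U i)).comp (hT.sub continuous_id)).const_smul
    (if e i then (1 : ℝ) else 0)

theorem measurable_iterates (hT : Continuous T) (k : ℕ) :
    Measurable[history ε k] fun ω => iterates T U z0 (fun j => ε j ω) k := by
  induction k with
  | zero => exact measurable_const
  | succ k ih =>
    have h1 : Measurable fun p : (Fin m → Bool) × PD r n => opThat T U p.1 p.2 :=
      measurable_from_prod_countable_right fun e => (continuous_opThat hT e).measurable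
    exact h1.comp ((measurable_history ε (Nat.lt_succ_self k)).prodMk
      (ih.mono (history_mono ε (Nat.le_succ k)) le_rfl))

/-- There are finitely many activation patterns, so each iterate takes finitely many values; every
function of it is bounded, which settles integrability. -/
theorem finite_range_iterates (k : ℕ) :
    (Set.range fun ω => iterates T U z0 (fun j => ε j ω) k).Finite := by
  induction k with
  | zero => exact (Set.finite_singleton z0).subset (by rintro _ ⟨ω, rfl⟩; rfl)
  | succ k ih =>
    refine (Set.Finite.image2 (opThat T U) Set.finite_univ ih).subset ?_
    rintro _ ⟨ω, rfl⟩
    exact ⟨ε k ω, Set.mem_univ _, _, ⟨ω, rfl⟩, rfl⟩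

theorem exists_bound_comp_iterates (G : PD r n → ℝ) (k : ℕ) :
    ∃ C, ∀ ω, ‖G (iterates T U z0 (fun j => ε j ω) k)‖ ≤ C := by
  obtain ⟨C, hC⟩ := ((finite_range_iterates (T := T) (U := U) (ε := ε) (z0 := z0) k).image
    fun z => ‖G z‖).bddAbove
  exact ⟨C, fun ω => hC ⟨_, ⟨ω, rfl⟩, rfl⟩⟩

theorem stronglyMeasurable_comp_iterates (hT : Continuous T) {G : PD r n → ℝ} (hG : Continuous G)
    (k : ℕ) : StronglyMeasurable[history ε k] fun ω => G (iterates T U z0 (fun j => ε j ω) k) :=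
  (hG.measurable.comp (measurable_iterates hT k)).stronglyMeasurable

theorem integrable_comp_iterates {μ : Measure Ω} [IsProbabilityMeasure μ]
    (hε : ∀ k, Measurable (ε k)) (hT : Continuous T) {G : PD r n → ℝ} (hG : Continuous G) (k : ℕ) :
    Integrable (fun ω => G (iterates T U z0 (fun j => ε j ω) k)) μ := by
  obtain ⟨C, hC⟩ := exists_bound_comp_iterates (T := T) (U := U) (ε := ε) (z0 := z0) G k
  exact Integrable.of_bound ((stronglyMeasurable_comp_iterates hT hG k).mono
    (history_le hε k)).aestronglyMeasurable C (Eventually.of_forall hC)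

/-- The conditional expectation of the weighted squared distance of the next iterate. -/
theorem condExp_normSqW_iterates {μ : Measure Ω} [IsProbabilityMeasure μ]
    (hε : ∀ k, Measurable (ε k)) (hind : iIndepFun ε μ)
    (hid : ∀ k, IdentDistrib (ε k) (ε 0) μ μ) (hpos : ∀ i, 0 < actProb μ ε i)
    (hU : ∀ i, U i = Matrix.diagonal fun j => if i = blk j then 1 else 0) (hT : Continuous T)
    (s : Fin r ⊕ Fin n → ℝ) (zs : PD r n) (k : ℕ) :
    μ[fun ω => normSqW (Matrix.diagonal fun j => (actProb μ ε (blk j))⁻¹ * s j)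
        (iterates T U z0 (fun j => ε j ω) (k + 1) - zs) | history ε k]
      =ᵐ[μ] fun ω =>
        normSqW (Matrix.diagonal fun j => (actProb μ ε (blk j))⁻¹ * s j)
          (iterates T U z0 (fun j => ε j ω) k - zs)
        + (2 * inner ℝ (app (Matrix.diagonal s)
            (T (iterates T U z0 (fun j => ε j ω) k) - iterates T U z0 (fun j => ε j ω) k))
            (iterates T U z0 (fun j => ε j ω) k - zs)
          + normSqW (Matrix.diagonal s)
            (T (iterates T U z0 (fun j => ε j ω) k) - iterates T U z0 (fun j => ε j ω) k)) := by
  set p := actProb μ ε with hp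
  set Z : Ω → PD r n := fun ω => iterates T U z0 (fun j => ε j ω) k with hZ
  let G : Fin r ⊕ Fin n → PD r n → ℝ := fun j z =>
    (p (blk j))⁻¹ * s j * (2 * (T z - z) j * (z - zs) j + (T z - z) j ^ 2)
  have hGc : ∀ j, Continuous (G j) := fun j => by
    have h1 : Continuous fun z => T z - z := hT.sub continuous_id
    have h2 : Continuous fun z => (T z - z) j :=
      (EuclideanSpace.proj (𝕜 := ℝ) j).continuous.comp h1
    have h3 : Continuous fun z : PD r n => (z - zs) j :=
      (EuclideanSpace.proj (𝕜 := ℝ) j).continuous.comp (continuous_id.sub continuous_const)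
    exact continuous_const.mul (((continuous_const.mul h2).mul h3).add (h2.pow 2))
  -- Since an indicator equals its square, each coordinate's increment is linear in the indicator of
  -- its block, with coefficient `G j` depending only on the past.
  have hstep : (fun ω => normSqW (Matrix.diagonal fun j => (p (blk j))⁻¹ * s j)
      (iterates T U z0 (fun j => ε j ω) (k + 1) - zs))
      = (fun ω => normSqW (Matrix.diagonal fun j => (p (blk j))⁻¹ * s j) (Z ω - zs))
        + ∑ j, fun ω => G j (Z ω) * (if ε k ω (blk j) then 1 else 0) := by
    funext ω
    rw [Pi.add_apply, Finset.sum_apply, normSqW_diagonal, normSqW_diagonal,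
      ← Finset.sum_add_distrib]
    refine Finset.sum_congr rfl fun j _ => ?_
    have e1 : (iterates T U z0 (fun j => ε j ω) (k + 1) - zs) j
        = (Z ω - zs) j + (if ε k ω (blk j) then 1 else 0) * (T (Z ω) - Z ω) j := by
      change opThat T U (ε k ω) (Z ω) j - zs j = _
      have e2 : (Z ω - zs) j = Z ω j - zs j := rfl
      rw [opThat_apply hU, e2]
      ring
    rw [e1]
    simp only [G]
    split_ifs <;> ring
  have hWc : Continuous fun z : PD r n =>
      normSqW (Matrix.diagonal fun j => (p (blk j))⁻¹ * s j) (z - zs) :=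
    (continuous_normSqW _).comp (continuous_id.sub continuous_const)
  have hint0 := integrable_comp_iterates (μ := μ) (U := U) (z0 := z0) hε hT hWc k
  have hint : ∀ j, Integrable (fun ω => G j (Z ω) * (if ε k ω (blk j) then (1 : ℝ) else 0)) μ := by
    intro j
    obtain ⟨C, hC⟩ := exists_bound_comp_iterates (T := T) (U := U) (ε := ε) (z0 := z0) (G j) k
    exact (integrable_activation hε k (blk j)).bdd_mul
      ((stronglyMeasurable_comp_iterates hT (hGc j) k).mono (history_le hε k)).aestronglyMeasurable
      (Eventually.of_forall hC)
  rw [hstep]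
  have h1 := condExp_add hint0 (integrable_finsetSum' Finset.univ fun j _ => hint j) (history ε k)
  have h2 := condExp_finsetSum (s := Finset.univ) (fun j _ => hint j) (history ε k)
  have h3 : ∀ j, μ[fun ω => G j (Z ω) * (if ε k ω (blk j) then (1 : ℝ) else 0) | history ε k]
      =ᵐ[μ] fun ω => G j (Z ω) * p (blk j) := by
    intro j
    obtain ⟨C, hC⟩ := exists_bound_comp_iterates (T := T) (U := U) (ε := ε) (z0 := z0) (G j) k
    exact condExp_activation_mul hε hind hid k (blk j)
      (stronglyMeasurable_comp_iterates hT (hGc j) k) hC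
  rw [condExp_of_stronglyMeasurable (history_le hε k)
    (stronglyMeasurable_comp_iterates hT hWc k) hint0] at h1
  filter_upwards [h1, h2, eventually_all.2 h3] with ω h1 h2 h3
  rw [h1, Pi.add_apply, h2, Finset.sum_apply, inner_diagonal, normSqW_diagonal s, Finset.mul_sum,
    ← Finset.sum_add_distrib]
  congr 1
  refine Finset.sum_congr rfl fun j _ => ?_
  rw [h3 j]
  -- The mean `p (blk j)` of the indicator cancels the weight `(p (blk j))⁻¹` inside `G j`.
  have := (hpos (blk j)).ne'
  simp only [G]
  field_simp
  rfl

end BlockIterates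

end TriPD

end

/-! ### The main theorem -/

open TriPD in
theorem mainTheorem2 {n r m : ℕ}
    -- problem data
    (f : EuclideanSpace ℝ (Fin n) → ℝ) (g : EuclideanSpace ℝ (Fin n) → EReal)
    (h : EuclideanSpace ℝ (Fin r) → EReal) (L : Matrix (Fin r) (Fin n) ℝ)
    (Q : Matrix (Fin n) (Fin n) ℝ) (β : ℝ)
    (hg : TriPD.ProperClosedConvex g) (hh : TriPD.ProperClosedConvex h)
    (hf_convex : ConvexOn ℝ Set.univ f) (hf_diff : ContDiff ℝ 1 f)
    (hQ : Q.PosDef) (hβ : 0 ≤ β)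
    (hf_lip : ∀ x y, TriPD.normW Q⁻¹ (gradient f x - gradient f y) ≤ β * TriPD.normW Q (x - y))
    (h_sol : ∃ x, TriPD.IsPrimalSolution f g h L x)
    (h_ri : ∃ x ∈ intrinsicInterior ℝ (TriPD.dom g),
      TriPD.app L x ∈ intrinsicInterior ℝ (TriPD.dom h))
    -- stepsizes
    (Sg : Matrix (Fin r) (Fin r) ℝ) (Gm : Matrix (Fin n) (Fin n) ℝ)
    (hSg : Sg.PosDef) (hGm : Gm.PosDef) (hSg_diag : Sg.IsDiag) (hGm_diag : Gm.IsDiag)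
    (h_step : (Gm⁻¹ - (β / 2) • Q - L.transpose * Sg * L).PosDef)
    -- blocks of coordinates
    (U : Fin m → Matrix (Fin r ⊕ Fin n) (Fin r ⊕ Fin n) ℝ)
    (hU_diag : ∀ i, (U i).IsDiag) (hU_01 : ∀ i j, U i j j = 0 ∨ U i j j = 1)
    (hU_sum : ∑ i, U i = 1)
    -- random activation
    {Ω : Type*} [MeasurableSpace Ω] (μ : Measure Ω) [IsProbabilityMeasure μ]
    (ε : ℕ → Ω → Fin m → Bool) (hε_meas : ∀ k, Measurable (ε k))
    (hε_indep : iIndepFun ε μ) (hε_ident : ∀ k, IdentDistrib (ε k) (ε 0) μ μ)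
    (hε_pos : ∀ i, 0 < TriPD.actProb μ ε i)
    -- starting point and iterates
    (z0 : TriPD.PD r n) (T : TriPD.PD r n → TriPD.PD r n) (hT : T = TriPD.opT f g h L Sg Gm)
    (z : ℕ → Ω → TriPD.PD r n)
    (hz : ∀ k ω, z k ω = TriPD.iterates T U z0 (fun j => ε j ω) k) :
    (∀ zs ∈ TriPD.solutionSet f g h L, ∀ k : ℕ,
      Integrable (fun ω => TriPD.normSqW
        ((TriPD.probMat (TriPD.actProb μ ε) U)⁻¹ * TriPD.matS Sg Gm) (z (k + 1) ω - zs)) μ ∧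
      μ[fun ω => TriPD.normSqW
          ((TriPD.probMat (TriPD.actProb μ ε) U)⁻¹ * TriPD.matS Sg Gm) (z (k + 1) ω - zs)
        | TriPD.history ε k]
        ≤ᵐ[μ] fun ω =>
          TriPD.normSqW
            ((TriPD.probMat (TriPD.actProb μ ε) U)⁻¹ * TriPD.matS Sg Gm) (z k ω - zs)
          - TriPD.normSqW
            ((2 : ℝ) • TriPD.matPtilde L Sg Gm Q β - TriPD.matS Sg Gm) (T (z k ω) - z k ω)) ∧
    ∃ zlim : Ω → TriPD.PD r n, Measurable zlim ∧ (∀ ω, zlim ω ∈ TriPD.solutionSet f g h L) ∧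
      ∀ᵐ ω ∂μ, Tendsto (fun k => z k ω) atTop (𝓝 (zlim ω)) := by
  classical
  subst hT
  obtain rfl : z = fun k ω =>
      iterates (opT f g h L Sg Gm) U z0 (fun j => ε j ω) k := by
    funext k ω; exact hz k ω
  obtain ⟨blk, hU⟩ := exists_block_map hU_diag hU_01 hU_sum
  obtain ⟨s, hs, hS⟩ := exists_matS_eq_diagonal hSg hGm hSg_diag hGm_diag
  have hTc : Continuous (opT f g h L Sg Gm) := continuous_opT hg hh hf_diff hSg hGm
  have hW : (probMat (actProb μ ε) U)⁻¹ * matS Sg Gm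
      = Matrix.diagonal fun j => (actProb μ ε (blk j))⁻¹ * s j := by
    rw [probMat_eq_diagonal hU, inv_diagonal_of_pos fun j => hε_pos (blk j), hS,
      Matrix.diagonal_mul_diagonal]
  have hWpos : (Matrix.diagonal fun j => (actProb μ ε (blk j))⁻¹ * s j).PosDef :=
    Matrix.PosDef.diagonal fun j => mul_pos (inv_pos.2 (hε_pos _)) (hs j)
  rw [hW]
  have hNc : ∀ zs : PD r n, Continuous fun z : PD r n =>
      normSqW (Matrix.diagonal fun j => (actProb μ ε (blk j))⁻¹ * s j) (z - zs) := fun zs =>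
    (continuous_normSqW _).comp (continuous_id.sub continuous_const)
  have hqc : Continuous fun z : PD r n => normSqW
      ((2 : ℝ) • matPtilde L Sg Gm Q β - matS Sg Gm) (opT f g h L Sg Gm z - z) :=
    (continuous_normSqW _).comp (hTc.sub continuous_id)
  obtain ⟨hq0, hq1⟩ := posDef_normSqW_two_matPtilde_sub_matS (L := L) hSg h_step
  have main : ∀ zs ∈ solutionSet f g h L, ∀ k : ℕ,
      Integrable (fun ω => normSqW
        (Matrix.diagonal fun j => (actProb μ ε (blk j))⁻¹ * s j)
        (iterates (opT f g h L Sg Gm) U z0 (fun j => ε j ω) (k + 1) - zs)) μ ∧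
      μ[fun ω => normSqW (Matrix.diagonal fun j => (actProb μ ε (blk j))⁻¹ * s j)
          (iterates (opT f g h L Sg Gm) U z0 (fun j => ε j ω) (k + 1) - zs) | history ε k]
        ≤ᵐ[μ] fun ω => normSqW (Matrix.diagonal fun j => (actProb μ ε (blk j))⁻¹ * s j)
            (iterates (opT f g h L Sg Gm) U z0 (fun j => ε j ω) k - zs)
          - normSqW ((2 : ℝ) • matPtilde L Sg Gm Q β - matS Sg Gm)
            (opT f g h L Sg Gm (iterates (opT f g h L Sg Gm) U z0 (fun j => ε j ω) k)
              - iterates (opT f g h L Sg Gm) U z0 (fun j => ε j ω) k) := by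
    intro zs hzs k
    refine ⟨integrable_comp_iterates hε_meas hTc (hNc zs) (k + 1), ?_⟩
    filter_upwards [condExp_normSqW_iterates (z0 := z0) hε_meas hε_indep hε_ident hε_pos hU hTc s
      zs k] with ω hω
    rw [hω, ← hS]
    have := two_inner_matS_add_le (Q := Q) (β := β) hg hh hf_diff hf_convex hQ hf_lip hSg hGm
      ((mem_solutionSet_iff hg hh hf_diff hf_convex h_ri zs).1 hzs)
      (iterates (opT f g h L Sg Gm) U z0 (fun j => ε j ω) k)
    linarith
  refine ⟨main, ?_⟩
  have hSne : (solutionSet f g h L).Nonempty := by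
    obtain ⟨x, hx⟩ := h_sol
    obtain ⟨u, hu⟩ := hx.exists_isKKT hg hh hf_diff hf_convex h_ri
    exact ⟨pair u x, (mem_solutionSet_iff hg hh hf_diff hf_convex h_ri _).2 hu⟩
  -- Countability of `D` lets the null sets belonging to the individual solutions be united.
  obtain ⟨D, hDS, hDc, hDd⟩ := (TopologicalSpace.IsSeparable.of_separableSpace
    (solutionSet f g h L)).exists_countable_dense_subset
  obtain ⟨c, hc, hcN⟩ := exists_mul_sq_norm_le_normSqW hWpos
  have hconv : ∀ᵐ ω ∂μ, ∃ x ∈ solutionSet f g h L, Tendsto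
      (fun k => iterates (opT f g h L Sg Gm) U z0 (fun j => ε j ω) k) atTop (𝓝 x) := by
    have hRS : ∀ zs ∈ solutionSet f g h L, ∀ᵐ ω ∂μ,
        (∃ l, Tendsto (fun k => normSqW
          (Matrix.diagonal fun j => (actProb μ ε (blk j))⁻¹ * s j)
          (iterates (opT f g h L Sg Gm) U z0 (fun j => ε j ω) k - zs)) atTop (𝓝 l)) ∧
        Tendsto (fun k => normSqW ((2 : ℝ) • matPtilde L Sg Gm Q β - matS Sg Gm)
            (opT f g h L Sg Gm (iterates (opT f g h L Sg Gm) U z0 (fun j => ε j ω) k)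
              - iterates (opT f g h L Sg Gm) U z0 (fun j => ε j ω) k)) atTop (𝓝 0) :=
      fun zs hzs => ae_tendsto_of_condExp_le_sub (ℱ := historyFiltration hε_meas)
        (fun k ω => normSqW_nonneg hWpos _) (fun k ω => hq0 _)
        (fun k => stronglyMeasurable_comp_iterates hTc (hNc zs) k)
        (fun k => stronglyMeasurable_comp_iterates hTc hqc k)
        (fun k => integrable_comp_iterates hε_meas hTc (hNc zs) k)
        (fun k => integrable_comp_iterates hε_meas hTc hqc k)
        (fun k => (main zs hzs k).2)
    obtain ⟨s₀, hs₀⟩ := hSne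
    filter_upwards [(ae_ball_iff hDc).2 fun zs hzs => hRS zs (hDS hzs), hRS s₀ hs₀] with ω h1 h2
    exact exists_tendsto_of_quasiFejer hTc
      (fun z hz => (mem_solutionSet_iff hg hh hf_diff hf_convex h_ri z).2
        (isKKT_of_opT_eq hg hh hSg hGm hz)) ⟨s₀, hs₀⟩ hDd (continuous_normSqW _) hq1
      (continuous_normSqW _) (normSqW_zero _) hc hcN (fun zs hzs => (h1 zs hzs).1) h2.2
  obtain ⟨zl, hzlm, hzl⟩ := measurable_limit_of_tendsto_metrizable_ae
    (fun k => ((measurable_iterates (ε := ε) (U := U) (z0 := z0) hTc k).mono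
      (history_le hε_meas k) le_rfl).aemeasurable)
    (hconv.mono fun ω ⟨x, _, hx⟩ => ⟨x, hx⟩)
  have hzlS : ∀ᵐ ω ∂μ, zl ω ∈ solutionSet f g h L := by
    filter_upwards [hconv, hzl] with ω ⟨x, hxS, hx⟩ hzl
    rwa [tendsto_nhds_unique hzl hx]
  obtain ⟨s₀, hs₀⟩ := hSne
  -- The limit is redefined as `s₀` on a measurable null set that contains all points where it is
  -- not a solution; this gives membership everywhere without measurability of the solution set.
  set N := toMeasurable μ {ω | zl ω ∈ solutionSet f g h L}ᶜ with hN
  have hN0 : μ N = 0 := by rw [hN, measure_toMeasurable]; exact hzlS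
  refine ⟨N.piecewise (fun _ => s₀) zl,
    measurable_const.piecewise (measurableSet_toMeasurable _ _) hzlm, fun ω => ?_, ?_⟩
  · by_cases hω : ω ∈ N
    · rw [Set.piecewise_eq_of_mem _ _ _ hω]
      exact hs₀
    · rw [Set.piecewise_eq_of_notMem _ _ _ hω]
      by_contra hn
      exact hω (subset_toMeasurable _ _ hn)
  · filter_upwards [hzl, measure_eq_zero_iff_ae_notMem.1 hN0] with ω h1 h2
    rwa [Set.piecewise_eq_of_notMem _ _ _ h2]
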